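/- All matrices are real. For $n\times n$ matrices we use the following terms. A matrix $A=[a_{ij}]$ is of *type D* with parameters $a_1<a_2<\dots<a_n$ if $a_{ij}=a_{\min(i,j)}$ for all $i,j$; it is of *flipped type D* with parameters $a_1>a_2>\dots>a_n$ if $a_{ij}=a_{\max(i,j)}$ for all $i,j$. For $0\le m\le n$, $C$ is a *cyclops with eye $m+$* and parameters $a_1,\dots,a_n,b_1,b_2$ if $$C=\begin{bmatrix} C_{11} & b_1E_{12}\\ b_2E_{21} & C_{22}\end{bmatrix},$$ where $C_{11}$ is an $m\times m$ flipped type D matrix with parameters $a_1,\dots,a_m$, $C_{22}$ is an $(n-m)\times(n-m)$ type D matrix with parameters $a_{m+1},\dots,a_n$, and $E_{12},E_{21}$ are all-ones matrices. $C=[c_{ij}]$ is a *generalized ultrametric matrix* if $c_{ij}\ge 0$ for all $i,j$; $c_{ii}\ge\max\{c_{ij},c_{ji}\}$ for all $i,j$; and every set of three distinct indices can be labelled $\{i,j,k\}$ so that $c_{ij}=c_{ik}$, $c_{ji}=c_{ki}$, $\min\{c_{jk},c_{kj}\}\ge\min\{c_{ji},c_{ij}\}$ and $\max\{c_{jk},c_{kj}\}\ge\max\{c_{ji},c_{ij}\}$.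 A matrix is *totally nonnegative* if all its minors are nonnegative. A matrix is *flat* if all its entries are equal. **Form (A).** A matrix of size $k\times k$ has form (A) if for some $m\in\{1,\dots,k\}$ it is a cyclops with eye $m+$ and parameters $a_i,b_1,b_2$ such that $$\min\{a_m,a_{m+1}\}\ge\max\{b_1,b_2\}\quad\text{and}\quad \min\{b_1,b_2\}>0$$ (if $m=k$, there is no $a_{m+1}$ and the first condition reads $a_m\ge\max\{b_1,b_2\}$). A nonsingular matrix of form (A) is called a *G-cyclops*. **Form (B).** A matrix has form (B) if it or its transpose is a block upper triangular matrix $$B=\begin{bmatrix} B_{11}&B_{12}&\cdots&B_{1m}\\ 0&B_{22}&\cdots&B_{2m}\\ \vdots&\ddots&\ddots&\vdots\\ 0&\cdots&0&B_{mm}\end{bmatrix},\qquad m\ge 2,$$ with square diagonal blocks, for which there are real numbers $f_{st}$ $(1\le s\le t\le m)$ and an integer $q$ with $1\le q\le m-1$ such that: - $B_{11}$ is a G-cyclops all of whose last-column entries equal $f_{11}$, and $B_{mm}$ is a G-cyclops all of whose first-row entries equal $f_{mm}$; - for $s<t$, the block $B_{st}$ is flat with all entries equal to $f_{st}$; - for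 $2\le s\le m-1$, the block $B_{ss}$ is either the $1\times1$ matrix $[f_{ss}]$ with $f_{ss}>0$, or $\begin{bmatrix} f_{ss}&f_{ss}\\ g_{ss}&f_{ss}\end{bmatrix}$ with $0<g_{ss}<f_{ss}$; - $f_{11}\ge f_{22}\ge\dots\ge f_{qq}>0$ and $0<f_{q+1,q+1}\le f_{q+2,q+2}\le\dots\le f_{mm}$; - $f_{1t}=f_{2t}=\dots=f_{t-1,t}=f_{tt}$ for $1<t\le q$; - $f_{ss}=f_{s,s+1}=\dots=f_{sm}$ for $q<s<m$; - $0<f_{st}=f_{q,q+1}\le\min\{f_{qq},f_{q+1,q+1}\}$ for $1\le s\le q<t\le m$. **Theorem.** Let $C\in\mathbb R^{n\times n}$ be nonsingular. The following are equivalent. 1. $C$ is a direct sum (a block diagonal matrix, with consecutive diagonal blocks) of matrices each of which has form (A) or form (B). 2. $C$ is a generalized ultrametric matrix and $C^{-1}$ is tridiagonal. 3. $C$ is a totally nonnegative generalized ultrametric matrix. -/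

import Mathlib

namespace InverseTridiagonal

/-- `A` is tridiagonal: `A i j = 0` whenever `|i - j| > 1`. -/
def IsTridiagonal {n : ℕ} (A : Matrix (Fin n) (Fin n) ℝ) : Prop :=
  ∀ i j : Fin n, (i.val + 1 < j.val ∨ j.val + 1 < i.val) → A i j = 0

/-- All minors (of all orders, rows and columns listed increasingly) are nonnegative. -/
def IsTotallyNonneg {n : ℕ} (A : Matrix (Fin n) (Fin n) ℝ) : Prop :=
  ∀ (k : ℕ) (r c : Fin k → Fin n), StrictMono r → StrictMono c → 0 ≤ (A.submatrix r c).det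

/-- Generalized ultrametric matrices. -/
structure IsGenUltrametric {n : ℕ} (C : Matrix (Fin n) (Fin n) ℝ) : Prop where
  nonneg : ∀ i j, 0 ≤ C i j
  diag : ∀ i j, max (C i j) (C j i) ≤ C i i
  triangle : ∀ S : Finset (Fin n), S.card = 3 → ∃ i j k, S = {i, j, k} ∧
    C i j = C i k ∧ C j i = C k i ∧
    min (C j i) (C i j) ≤ min (C j k) (C k j) ∧
    max (C j i) (C i j) ≤ max (C j k) (C k j)

/-- `A` is of type D with parameters `a`. -/
def IsTypeD {n : ℕ} (A : Matrix (Fin n) (Fin n) ℝ) (a : Fin n → ℝ) : Prop :=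
  StrictMono a ∧ ∀ i j, A i j = if i ≤ j then a i else a j

/-- `A` is of flipped type D with parameters `a`: reversing the order of the indices gives a
type D matrix (the `i`-th parameter being the `i`-th diagonal entry of `A`). -/
def IsFlippedTypeD {n : ℕ} (A : Matrix (Fin n) (Fin n) ℝ) (a : Fin n → ℝ) : Prop :=
  IsTypeD (A.submatrix Fin.rev Fin.rev) (fun i => a i.rev)

/-- `C` is a cyclops with eye `m+` and parameters `a`, `b₁`, `b₂`. -/
def IsCyclops {n : ℕ} (C : Matrix (Fin n) (Fin n) ℝ) (m : ℕ) (a : Fin n → ℝ) (b₁ b₂ : ℝ) :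
    Prop :=
  ∃ (p : ℕ) (h : m + p = n) (C₁₁ : Matrix (Fin m) (Fin m) ℝ) (C₂₂ : Matrix (Fin p) (Fin p) ℝ),
    IsFlippedTypeD C₁₁ (fun i => a (Fin.cast h (Fin.castAdd p i))) ∧
    IsTypeD C₂₂ (fun i => a (Fin.cast h (Fin.natAdd m i))) ∧
    C.submatrix (fun x => Fin.cast h (finSumFinEquiv x)) (fun x => Fin.cast h (finSumFinEquiv x)) =
      Matrix.fromBlocks C₁₁ (Matrix.of fun _ _ => b₁) (Matrix.of fun _ _ => b₂) C₂₂

/-- `C` is a cyclops with some eye `m+`, `1 ≤ m ≤ n`, whose parameters satisfy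
`min {a_m, a_{m+1}} ≥ max {b₁, b₂}` and `min {b₁, b₂} > 0`. In the zero-based indexing, `a_m` and
`a_{m+1}` are the values of `a` at `m - 1` and `m`; if `m = n` there is no `a_{m+1}`. -/
def IsPositiveCyclops {n : ℕ} (C : Matrix (Fin n) (Fin n) ℝ) : Prop :=
  ∃ (m : ℕ) (a : Fin n → ℝ) (b₁ b₂ : ℝ), 1 ≤ m ∧ m ≤ n ∧ IsCyclops C m a b₁ b₂ ∧
    (∀ i : Fin n, (i.val + 1 = m ∨ i.val = m) → max b₁ b₂ ≤ a i) ∧ 0 < min b₁ b₂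

/-- G-cyclopses. -/
def IsGCyclops {n : ℕ} (C : Matrix (Fin n) (Fin n) ℝ) : Prop :=
  IsUnit C ∧ IsPositiveCyclops C

/-- The place in `Fin n` of the index `x.2` of the block `x.1`, when `Fin n` is cut into `m`
consecutive blocks of sizes `d 0, …, d (m - 1)`. -/
def blockIndex {n m : ℕ} (d : Fin m → ℕ) (h : ∑ s, d s = n) (x : (s : Fin m) × Fin (d s)) :
    Fin n :=
  Fin.cast h (finSigmaFinEquiv x)

/-- The block `B_{st}` of a matrix partitioned into consecutive blocks of sizes `d`. -/
def block {n m : ℕ} (d : Fin m → ℕ) (h : ∑ s, d s = n) (B : Matrix (Fin n) (Fin n) ℝ)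
    (s t : Fin m) : Matrix (Fin (d s)) (Fin (d t)) ℝ :=
  Matrix.of fun i j => B (blockIndex d h ⟨s, i⟩) (blockIndex d h ⟨t, j⟩)

/-- The conditions on a matrix `B`, block upper triangular with `m × m` blocks of sizes `d`, in
terms of the values `f s t` and the number `q`. Blocks are numbered from `0` to `m - 1`, so the
first `q` blocks are those with `s < q`. -/
structure IsNestedBlock {n m : ℕ} (d : Fin m → ℕ) (h : ∑ s, d s = n)
    (B : Matrix (Fin n) (Fin n) ℝ) (f : Fin m → Fin m → ℝ) (q : ℕ) : Prop where
  one_le_q : 1 ≤ q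
  q_lt : q < m
  /-- The blocks below the diagonal vanish. -/
  lower : ∀ s t, t < s → block d h B s t = 0
  /-- The first diagonal block is a G-cyclops with constant last column. -/
  first : ∀ s, s.val = 0 → IsGCyclops (block d h B s s) ∧
    ∀ i j, j.val + 1 = d s → block d h B s s i j = f s s
  /-- The last diagonal block is a G-cyclops with constant first row. -/
  last : ∀ s, s.val + 1 = m → IsGCyclops (block d h B s s) ∧
    ∀ i j, i.val = 0 → block d h B s s i j = f s s
  /-- The blocks above the diagonal are flat. -/
  upper : ∀ s t, s < t → block d h B s t = Matrix.of fun _ _ => f s t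
  /-- The other diagonal blocks are a positive number or a positive `2 × 2` matrix. -/
  middle : ∀ s, 0 < s.val → s.val + 1 < m →
    (∃ h₁ : d s = 1, 0 < f s s ∧
      (block d h B s s).reindex (finCongr h₁) (finCongr h₁) = !![f s s]) ∨
    (∃ (h₂ : d s = 2) (g : ℝ), 0 < g ∧ g < f s s ∧
      (block d h B s s).reindex (finCongr h₂) (finCongr h₂) = !![f s s, f s s; g, f s s])
  left_anti : ∀ s t, s ≤ t → t.val < q → f t t ≤ f s s
  left_pos : ∀ s, s.val < q → 0 < f s s
  right_mono : ∀ s t, s ≤ t → q ≤ s.val → f s s ≤ f t t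
  right_pos : ∀ s, q ≤ s.val → 0 < f s s
  left_eq : ∀ s t, s < t → t.val < q → f s t = f t t
  right_eq : ∀ s t, s < t → q ≤ s.val → f s t = f s s
  /-- `u` and `v` are the `q`-th and the `(q+1)`-st block. -/
  cross : ∀ u v, u.val + 1 = q → v.val = q → ∀ s t, s.val < q → q ≤ t.val →
    0 < f s t ∧ f s t = f u v ∧ f s t ≤ min (f u u) (f v v)

/-- `B` has the nested block upper triangular form for some partition and some values. -/
def IsNestedUpper {n : ℕ} (B : Matrix (Fin n) (Fin n) ℝ) : Prop :=
  ∃ (m : ℕ) (d : Fin m → ℕ) (h : ∑ s, d s = n) (f : Fin m → Fin m → ℝ) (q : ℕ),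
    IsNestedBlock d h B f q

/-- `C` is the direct sum (in this order) of matrices that all have the property `P`. -/
def IsDirectSumOf (P : ∀ k : ℕ, Matrix (Fin k) (Fin k) ℝ → Prop) {n : ℕ}
    (C : Matrix (Fin n) (Fin n) ℝ) : Prop :=
  ∃ (m : ℕ) (d : Fin m → ℕ) (h : ∑ s, d s = n) (M : ∀ s, Matrix (Fin (d s)) (Fin (d s)) ℝ),
    (∀ s, P (d s) (M s)) ∧
    C.submatrix (blockIndex d h) (blockIndex d h) = Matrix.blockDiagonal' M

end InverseTridiagonal

namespace InverseTridiagonal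

/-! For nonsingular generalized ultrametric matrices all three conditions amount to one entrywise
identity, the Markov property `c i l * c j j = c i j * c j l` for `j` between `i` and `l`, on both
sides of the diagonal; hence the pivot notion `IsMarkovUltrametric`.

The path product inequality `C i j * C j l ≤ C i l * C j j` holds in every generalized ultrametric
matrix. Total nonnegativity supplies the reverse inequality through `2 × 2` minors. A tridiagonal
inverse gives the identity by a linear algebra argument on two columns
(`markov_of_isTridiagonal_inv`). Conversely, the Markov property lets two bidiagonal factors
diagonalize `C`, which makes the inverse tridiagonal. It also makes adjacent columns or rows of a
submatrix proportional up to one entry, so that minors factor into nonnegative terms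
(`det_submatrix_nonneg`).

To reach the block forms, in a triple `i < j < l` the Markov property together with the choice of
apex forces entries next to `j` to equal `c j j`; the pattern of zeros decides on which side.
Cutting where both entries next to the diagonal vanish gives irreducible segments, whose zeros lie
on one side only (`pos_upper_or_lower`). A segment without zeros is a cyclops (`exists_eye`).
Otherwise it has a descending part followed by an ascending part (`exists_split`), and cutting it at
its zeros produces the nested form. The converse is an entrywise check, in which nested matrices
pass through the block-free description `IsNested`. -/

/-- The index `i` of the triple `{i, j, k}` is in the same position with respect to `j` and to `k`,
which are at least as close to each other as they are to `i`. -/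
def IsApex {ι : Type*} (c : ι → ι → ℝ) (i j k : ι) : Prop :=
  c i j = c i k ∧ c j i = c k i ∧ min (c j i) (c i j) ≤ min (c j k) (c k j) ∧
    max (c j i) (c i j) ≤ max (c j k) (c k j)

theorem IsApex.symm {ι : Type*} {c : ι → ι → ℝ} {i j k : ι} (h : IsApex c i j k) :
    IsApex c i k j := by
  obtain ⟨h₁, h₂, h₃, h₄⟩ := h
  refine ⟨h₁.symm, h₂.symm, ?_, ?_⟩
  · rw [← h₁, ← h₂, min_comm (c k j)]; exact h₃
  · rw [← h₁, ← h₂, max_comm (c k j)]; exact h₄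

theorem IsApex.swap {ι : Type*} {c : ι → ι → ℝ} {i j k : ι} (h : IsApex c i j k) :
    IsApex (fun x y => c y x) i j k := by
  obtain ⟨h₁, h₂, h₃, h₄⟩ := h
  refine ⟨h₂, h₁, ?_, ?_⟩
  · rw [min_comm, min_comm (c k j)]; exact h₃
  · rw [max_comm, max_comm (c k j)]; exact h₄

/-- Generalized ultrametric functions with the Markov property `c i l * c j j = c i j * c j l` for
`j` between `i` and `l`. -/
structure IsMarkovUltrametric {ι : Type*} [LinearOrder ι] (c : ι → ι → ℝ) : Prop where
  nonneg : ∀ i j, 0 ≤ c i j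
  le_left : ∀ i j, c i j ≤ c i i
  le_right : ∀ i j, c i j ≤ c j j
  apex : ∀ i j l, i < j → j < l → IsApex c i j l ∨ IsApex c j i l ∨ IsApex c l i j
  upper : ∀ i j l, i < j → j < l → c i l * c j j = c i j * c j l
  lower : ∀ i j l, i < j → j < l → c l i * c j j = c l j * c j i

theorem IsMarkovUltrametric.swap {ι : Type*} [LinearOrder ι] {c : ι → ι → ℝ}
    (h : IsMarkovUltrametric c) : IsMarkovUltrametric (fun x y => c y x) where
  nonneg i j := h.nonneg j i
  le_left i j := h.le_right j i
  le_right i j := h.le_left j i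
  apex i j l hij hjl := (h.apex i j l hij hjl).imp IsApex.swap (Or.imp IsApex.swap IsApex.swap)
  upper i j l hij hjl := by rw [h.lower i j l hij hjl, mul_comm]
  lower i j l hij hjl := by rw [h.upper i j l hij hjl, mul_comm]

theorem IsMarkovUltrametric.comp {ι κ : Type*} [LinearOrder ι] [LinearOrder κ] {c : ι → ι → ℝ}
    (h : IsMarkovUltrametric c) {e : κ → ι} (he : StrictMono e) :
    IsMarkovUltrametric (fun x y => c (e x) (e y)) where
  nonneg _ _ := h.nonneg _ _
  le_left _ _ := h.le_left _ _
  le_right _ _ := h.le_right _ _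
  apex _ _ _ hij hjl := h.apex _ _ _ (he hij) (he hjl)
  upper _ _ _ hij hjl := h.upper _ _ _ (he hij) (he hjl)
  lower _ _ _ hij hjl := h.lower _ _ _ (he hij) (he hjl)

/-! ### Generalized ultrametric matrices and the path product inequality -/

section

variable {n : ℕ} {C : Matrix (Fin n) (Fin n) ℝ}

theorem IsGenUltrametric.le_left (h : IsGenUltrametric C) (i j : Fin n) : C i j ≤ C i i :=
  (le_max_left _ _).trans (h.diag i j)

theorem IsGenUltrametric.le_right (h : IsGenUltrametric C) (i j : Fin n) : C i j ≤ C j j :=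
  (le_max_right _ _).trans (h.diag j i)

theorem IsGenUltrametric.apex (h : IsGenUltrametric C) {i j l : Fin n} (hij : i ≠ j) (hjl : j ≠ l)
    (hil : i ≠ l) : IsApex C i j l ∨ IsApex C j i l ∨ IsApex C l i j := by
  obtain ⟨x, y, z, hS, hx⟩ := h.triangle {i, j, l} (Finset.card_eq_three.2 ⟨i, j, l, hij, hil, hjl, rfl⟩)
  have hx : IsApex C x y z := hx
  have hcard : ({x, y, z} : Finset (Fin n)).card = 3 := by
    rw [← hS]; exact Finset.card_eq_three.2 ⟨i, j, l, hij, hil, hjl, rfl⟩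
  have hx' := hx.symm
  have h₁ : i ∈ ({x, y, z} : Finset (Fin n)) := by rw [← hS]; simp
  have h₂ : j ∈ ({x, y, z} : Finset (Fin n)) := by rw [← hS]; simp
  have h₃ : l ∈ ({x, y, z} : Finset (Fin n)) := by rw [← hS]; simp
  simp only [Finset.mem_insert, Finset.mem_singleton] at h₁ h₂ h₃
  rcases h₁ with rfl | rfl | rfl <;> rcases h₂ with rfl | rfl | rfl <;>
    rcases h₃ with rfl | rfl | rfl <;> simp_all

/-- If `i` or `l` is the apex, one factor occurs on both sides and the other is bounded by `C j j`.
If `j` is the apex, the left side is `C i j * C j i`, the product of a minimum, which is at most `C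
i l`, and a maximum, which is at most `C j j`. -/
theorem IsGenUltrametric.path_product (h : IsGenUltrametric C) (i j l : Fin n) :
    C i j * C j l ≤ C i l * C j j := by
  have a₁ := h.le_left i j
  have a₂ := h.le_right i j
  have a₃ := h.le_left j l
  have a₄ := h.le_right j l
  have a₅ := h.le_left j i
  have a₆ := h.le_right j i
  have n₁ := h.nonneg
  by_cases hij : i = j
  · subst hij; rw [mul_comm]
  by_cases hjl : j = l
  · subst hjl; exact le_rfl
  by_cases hil : i = l
  · subst hil
    exact mul_le_mul a₁ a₃ (n₁ _ _) (n₁ _ _)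
  rcases h.apex hij hjl hil with ⟨h₁, h₂, -, -⟩ | ⟨h₁, h₂, h₃, h₄⟩ | ⟨h₁, h₂, -, -⟩
  · rw [← h₁]; exact mul_le_mul_of_nonneg_left a₃ (n₁ _ _)
  · rw [← h₁, ← min_mul_max (C i j) (C j i)]
    exact mul_le_mul (h₃.trans (min_le_left _ _)) (max_le a₂ a₅)
      ((n₁ i j).trans (le_max_left _ _)) (n₁ _ _)
  · rw [← h₂, mul_comm]; exact mul_le_mul_of_nonneg_left a₂ (n₁ _ _)

theorem IsMarkovUltrametric.isGenUltrametric (h : IsMarkovUltrametric C) : IsGenUltrametric C where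
  nonneg := h.nonneg
  diag i j := max_le (h.le_left i j) (h.le_right j i)
  triangle S hS := by
    have key : ∀ i j l : Fin n, i < j → j < l → ∃ x y z, ({i, j, l} : Finset (Fin n)) = {x, y, z} ∧
        IsApex C x y z := by
      intro i j l hij hjl
      rcases h.apex i j l hij hjl with h | h | h
      · exact ⟨i, j, l, rfl, h⟩
      · exact ⟨j, i, l, by ext; simp; tauto, h⟩
      · exact ⟨l, i, j, by ext; simp; tauto, h⟩
    let e := S.orderEmbOfFin hS
    have he : ({e 0, e 1, e 2} : Finset (Fin n)) = S := by
      have hu : (Finset.univ : Finset (Fin 3)) = {0, 1, 2} := by decide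
      rw [← Finset.image_orderEmbOfFin_univ S hS, hu]
      simp [e]
    rw [← he]
    exact key _ _ _ (e.strictMono (by decide)) (e.strictMono (by decide))

theorem IsGenUltrametric.isMarkovUltrametric (h : IsGenUltrametric C)
    (hu : ∀ i j l, i < j → j < l → C i l * C j j = C i j * C j l)
    (hl : ∀ i j l, i < j → j < l → C l i * C j j = C l j * C j i) : IsMarkovUltrametric C where
  nonneg := h.nonneg
  le_left := h.le_left
  le_right := h.le_right
  apex _ _ _ hij hjl := h.apex hij.ne hjl.ne (hij.trans hjl).ne
  upper := hu
  lower := hl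

theorem IsGenUltrametric.diag_pos (h : IsGenUltrametric C) (hC : IsUnit C) (i : Fin n) :
    0 < C i i := by
  refine (h.nonneg i i).lt_of_ne' fun h0 => ?_
  rw [Matrix.isUnit_iff_isUnit_det] at hC
  refine hC.ne_zero (Matrix.det_eq_zero_of_row_eq_zero i fun j => ?_)
  exact le_antisymm (h0 ▸ h.le_left i j) (h.nonneg i j)

/-! ### Totally nonnegative matrices -/

/-- The minor with rows `i, j` and columns `j, l`, and its mirror image, is exactly the reverse of
the path product inequality. -/
theorem IsTotallyNonneg.isMarkovUltrametric (hT : IsTotallyNonneg C) (h : IsGenUltrametric C) :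
    IsMarkovUltrametric C := by
  have key : ∀ i j k l, i < j → k < l → C i l * C j k ≤ C i k * C j l := by
    intro i j k l hij hkl
    have := hT 2 ![i, j] ![k, l] (by simpa [Fin.strictMono_iff_lt_succ] using hij)
      (by simpa [Fin.strictMono_iff_lt_succ] using hkl)
    rw [Matrix.det_fin_two] at this
    simpa using this
  refine h.isMarkovUltrametric (fun i j l hij hjl => ?_) (fun i j l hij hjl => ?_)
  · exact le_antisymm (key _ _ _ _ hij hjl) (h.path_product i j l)
  · refine le_antisymm ?_ (h.path_product l j i)
    linarith [key j l i j hjl hij]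

/-- Subtracting `t` times column `j` from the last column clears it except in the last row. -/
theorem det_eq_of_last_col {k : ℕ} (N : Matrix (Fin (k + 1)) (Fin (k + 1)) ℝ) (j : Fin k) (t : ℝ)
    (hN : ∀ i : Fin k, N i.castSucc (Fin.last k) = t * N i.castSucc j.castSucc) :
    N.det = (N (Fin.last k) (Fin.last k) - t * N (Fin.last k) j.castSucc) *
      (N.submatrix Fin.castSucc Fin.castSucc).det := by
  rw [← Matrix.det_updateCol_add_smul_self N (Fin.castSucc_lt_last j).ne' (-t),
    Matrix.det_succ_column _ (Fin.last k), Fin.sum_univ_castSucc, Finset.sum_eq_zero]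
  · have : (N.updateCol (Fin.last k) fun i => N i (Fin.last k) + -t • N i j.castSucc).submatrix
        (Fin.last k).succAbove (Fin.last k).succAbove = N.submatrix Fin.castSucc Fin.castSucc := by
      ext x y
      simp
    rw [this]
    simp [← two_mul, sub_eq_add_neg]
  · intro i _
    simp [hN i]

/-- Let `p` be the larger of the penultimate row and column indices. If it is the column index, all
rows but the last are at most `p`, so by the Markov property through `p` the last column is a
multiple of the penultimate one in those rows. The determinant then factors into a smaller minor and
a term that is nonnegative by the path product inequality. The other case is the transpose. -/
theorem IsMarkovUltrametric.det_submatrix_nonneg (h : IsMarkovUltrametric C)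
    (hpos : ∀ i, 0 < C i i) (k : ℕ) (r c : Fin k → Fin n) (hr : StrictMono r)
    (hc : StrictMono c) : 0 ≤ (C.submatrix r c).det := by
  have hp := h.isGenUltrametric.path_product
  induction k with
  | zero => simp
  | succ k ih =>
    have ih' := ih (r ∘ Fin.castSucc) (c ∘ Fin.castSucc) (hr.comp Fin.strictMono_castSucc)
      (hc.comp Fin.strictMono_castSucc)
    rcases k with _ | k
    · simpa using h.nonneg _ _
    rcases le_total (r (Fin.last k).castSucc) (c (Fin.last k).castSucc) with hrc | hrc
    · set p := c (Fin.last k).castSucc with hpdef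
      have hpc : p < c (Fin.last (k + 1)) := hc (Fin.castSucc_lt_last _)
      rw [det_eq_of_last_col _ (Fin.last k) (C p (c (Fin.last _)) / C p p)]
      · refine mul_nonneg ?_ ih'
        have := hp (r (Fin.last _)) p (c (Fin.last _))
        simp only [Matrix.submatrix_apply, ← hpdef, sub_nonneg]
        rw [div_mul_eq_mul_div, div_le_iff₀ (hpos p)]
        linarith
      · intro i
        have hi : r i.castSucc ≤ p := (hr.monotone (Fin.castSucc_le_castSucc_iff.2 i.le_last)).trans hrc
        simp only [Matrix.submatrix_apply, ← hpdef]
        rw [div_mul_eq_mul_div, eq_div_iff (hpos p).ne']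
        rcases hi.eq_or_lt with hi | hi
        · rw [hi]
        · rw [h.upper _ _ _ hi hpc, mul_comm]
    · set p := r (Fin.last k).castSucc with hpdef
      have hpc : p < r (Fin.last (k + 1)) := hr (Fin.castSucc_lt_last _)
      rw [← Matrix.det_transpose, det_eq_of_last_col _ (Fin.last k) (C (r (Fin.last _)) p / C p p)]
      · rw [← Matrix.det_transpose] at ih'
        refine mul_nonneg ?_ ih'
        have := hp (r (Fin.last _)) p (c (Fin.last _))
        simp only [Matrix.transpose_apply, Matrix.submatrix_apply, ← hpdef, sub_nonneg]
        rw [div_mul_eq_mul_div, div_le_iff₀ (hpos p)]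
        linarith
      · intro i
        have hi : c i.castSucc ≤ p := (hc.monotone (Fin.castSucc_le_castSucc_iff.2 i.le_last)).trans hrc
        simp only [Matrix.transpose_apply, Matrix.submatrix_apply, ← hpdef]
        rw [div_mul_eq_mul_div, eq_div_iff (hpos p).ne']
        rcases hi.eq_or_lt with hi | hi
        · rw [hi]
        · rw [h.lower _ _ _ hi hpc]

/-! ### Tridiagonal inverses -/

/-- The combination `z` of columns `j` and `l` vanishes at `j`, and `C⁻¹` maps it to a vector
vanishing before `j`. By tridiagonality its truncation `w` to the indices before `j` is mapped to a
multiple of the `j`-th unit vector, so `w` is a multiple of column `j` of `C`. Since `w j = 0 < C j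
j`, that multiple is zero, and `w i = 0` is the claim. -/
theorem markov_of_isTridiagonal_inv (hC : IsUnit C) (hT : IsTridiagonal C⁻¹)
    (hpos : ∀ i, 0 < C i i) (i j l : Fin n) (hij : i < j) (hjl : j < l) :
    C i l * C j j = C i j * C j l := by
  have hdet := (Matrix.isUnit_iff_isUnit_det C).1 hC
  have hAC : C⁻¹ * C = 1 := Matrix.nonsing_inv_mul C hdet
  have hCA : C * C⁻¹ = 1 := Matrix.mul_nonsing_inv C hdet
  set A := C⁻¹
  let z : Fin n → ℝ := fun k => C j l * C k j - C j j * C k l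
  let w : Fin n → ℝ := fun k => if k < j then z k else 0
  have hAz : ∀ r < j, (A.mulVec z) r = 0 := by
    intro r hr
    have h₁ : ∑ k, A r k * C k j = 0 := by
      have := congrFun (congrFun hAC r) j
      rwa [Matrix.mul_apply, Matrix.one_apply_ne hr.ne] at this
    have h₂ : ∑ k, A r k * C k l = 0 := by
      have := congrFun (congrFun hAC r) l
      rwa [Matrix.mul_apply, Matrix.one_apply_ne (hr.trans hjl).ne] at this
    simp only [Matrix.mulVec, dotProduct]
    calc ∑ k, A r k * z k = C j l * ∑ k, A r k * C k j - C j j * ∑ k, A r k * C k l := by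
          rw [Finset.mul_sum, Finset.mul_sum, ← Finset.sum_sub_distrib]
          exact Finset.sum_congr rfl fun k _ => by simp only [z]; ring
      _ = 0 := by rw [h₁, h₂]; ring
  have hAw : ∀ r, r ≠ j → (A.mulVec w) r = 0 := by
    intro r hr
    rcases lt_or_gt_of_ne hr with hr | hr
    · rw [← hAz r hr]
      simp only [Matrix.mulVec, dotProduct]
      refine Finset.sum_congr rfl fun k _ => ?_
      simp only [w]
      split_ifs with hk
      · rfl
      -- The discarded terms contribute nothing: `z j = 0`, and any `k > j > r` is out of reach of
      -- row `r`.
      · rcases (not_lt.1 hk).eq_or_lt with rfl | hk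
        · simp only [z]; ring
        · rw [hT r k (Or.inl (by omega))]; simp
    · simp only [Matrix.mulVec, dotProduct]
      refine Finset.sum_eq_zero fun k _ => ?_
      simp only [w]
      split_ifs with hk
      · rw [hT r k (Or.inr (by omega))]; simp
      · simp
  have hAw' : A.mulVec w = Pi.single j ((A.mulVec w) j) := by
    ext r
    by_cases hr : r = j
    · subst hr; simp
    · rw [hAw r hr, Pi.single_eq_of_ne hr]
  have hw : w = fun r => C r j * (A.mulVec w) j := by
    calc w = (C * A).mulVec w := by rw [hCA, Matrix.one_mulVec]
      _ = C.mulVec (A.mulVec w) := (Matrix.mulVec_mulVec _ _ _).symm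
      _ = _ := by
        rw [hAw']; ext r; simp
  have hj := congrFun hw j
  have hi := congrFun hw i
  have h0 : (A.mulVec w) j = 0 := by
    simp only [w, lt_irrefl, if_false] at hj
    rcases mul_eq_zero.1 hj.symm with h | h
    · exact absurd h (hpos j).ne'
    · exact h
  rw [h0] at hi
  simp only [w, hij, if_true, z] at hi
  linarith

theorem IsGenUltrametric.isMarkovUltrametric_of_inv (h : IsGenUltrametric C) (hC : IsUnit C)
    (hT : IsTridiagonal C⁻¹) : IsMarkovUltrametric C := by
  have hpos := h.diag_pos hC
  refine h.isMarkovUltrametric (markov_of_isTridiagonal_inv hC hT hpos) fun i j l hij hjl => ?_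
  have := markov_of_isTridiagonal_inv (C := C.transpose)
    ((Matrix.isUnit_transpose C).2 hC)
    (fun i j hij => by rw [← Matrix.transpose_nonsing_inv]; exact hT j i hij.symm) hpos i j l hij hjl
  simpa [mul_comm] using this

/-! ### Bidiagonal elimination -/

/-- The unit upper bidiagonal matrix that makes a Markov matrix lower triangular. -/
noncomputable def eliminator (C : Matrix (Fin n) (Fin n) ℝ) : Matrix (Fin n) (Fin n) ℝ :=
  Matrix.of fun i j => if i = j then 1 else if i.val + 1 = j.val then -(C i j / C i i) else 0

theorem mul_eliminator_zero {i j : Fin n} (hj : j.val = 0) :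
    (C * eliminator C) i j = C i j := by
  rw [Matrix.mul_apply, Finset.sum_eq_single j]
  · simp [eliminator]
  · intro k _ hk
    have : ¬ k.val + 1 = j.val := by omega
    simp [eliminator, hk, this]
  · simp

theorem mul_eliminator_succ {i j k : Fin n} (hj : k.val + 1 = j.val) :
    (C * eliminator C) i j = C i j - C i k * C k j / C k k := by
  have hkj : k ≠ j := by rintro rfl; omega
  rw [Matrix.mul_apply, Finset.sum_eq_add j k hkj.symm]
  · simp [eliminator, hkj, hj]; ring
  · intro x _ hx
    have : ¬ x.val + 1 = j.val := by have := hx.2; omega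
    simp [eliminator, hx.1, this]
  · simp
  · simp

theorem mul_eliminator_of_lt (h : IsMarkovUltrametric C) (hpos : ∀ i, 0 < C i i) {i j : Fin n}
    (hij : i < j) : (C * eliminator C) i j = 0 := by
  have hk : (⟨j.val - 1, by omega⟩ : Fin n).val + 1 = j.val := by simp; omega
  rw [mul_eliminator_succ hk, sub_eq_zero, eq_div_iff (hpos _).ne']
  rcases (show i ≤ ⟨j.val - 1, by omega⟩ by simp [Fin.le_def]; omega).eq_or_lt with hi | hi
  · rw [← hi, mul_comm]
  · exact h.upper _ _ _ hi (by simp [Fin.lt_def]; omega)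

theorem det_eliminator : (eliminator C).det = 1 := by
  rw [Matrix.det_of_isUpperTriangular]
  · simp [eliminator]
  · intro i j hij
    simp only [id] at hij
    have h₁ : i ≠ j := hij.ne'
    have h₂ : ¬ i.val + 1 = j.val := by omega
    simp [eliminator, h₁, h₂]

/-- The eliminator has determinant one and the product is lower triangular. Its diagonal entries are
adjacent principal `2 × 2` minors divided by a diagonal entry, apart from the first, which is a
diagonal entry of `C`. -/
theorem det_eq_prod_mul_eliminator (h : IsMarkovUltrametric C) (hpos : ∀ i, 0 < C i i) :
    C.det = ∏ i, (C * eliminator C) i i := by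
  rw [← Matrix.det_of_isLowerTriangular, Matrix.det_mul, det_eliminator, mul_one]
  intro i j hij
  exact mul_eliminator_of_lt h hpos hij

/-- A Markov ultrametric matrix is nonsingular if and only if its principal `2 × 2` minors with
consecutive indices are nonzero. -/
theorem isUnit_iff_adjacent (h : IsMarkovUltrametric C) (hpos : ∀ i, 0 < C i i) :
    IsUnit C ↔ ∀ i j : Fin n, i.val + 1 = j.val → C i j * C j i < C i i * C j j := by
  rw [Matrix.isUnit_iff_isUnit_det, det_eq_prod_mul_eliminator h hpos, isUnit_iff_ne_zero,
    Finset.prod_ne_zero_iff]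
  constructor
  · intro hne i j hij
    refine (mul_le_mul (h.le_left i j) (h.le_left j i) (h.nonneg _ _) (h.nonneg _ _)).lt_of_ne ?_
    intro heq
    apply hne j (Finset.mem_univ _)
    rw [mul_eliminator_succ hij, sub_eq_zero, eq_div_iff (hpos _).ne']
    linarith
  · intro hlt j _
    rcases Nat.eq_zero_or_pos j.val with hj | hj
    · rw [mul_eliminator_zero hj]; exact (hpos j).ne'
    · have hk : (⟨j.val - 1, by omega⟩ : Fin n).val + 1 = j.val := by simp; omega
      rw [mul_eliminator_succ hk, Ne, sub_eq_zero, eq_div_iff (hpos _).ne']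
      linarith [hlt _ _ hk]

theorem eliminator_of_far {i j : Fin n} (h₁ : i ≠ j) (h₂ : i.val + 1 ≠ j.val) :
    eliminator C i j = 0 := by
  simp [eliminator, h₁, h₂]

/-- With `U` the eliminator of `C` and `V` the transposed eliminator of the transpose, `C * U` is
lower and `V * C` upper triangular. Hence `V * C * U` is both, so it is diagonal, and `C⁻¹ = U * D⁻¹
* V` is a product of an upper bidiagonal, a diagonal and a lower bidiagonal matrix. -/
theorem IsMarkovUltrametric.isTridiagonal_inv (h : IsMarkovUltrametric C) (hpos : ∀ i, 0 < C i i)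
    (hC : IsUnit C) : IsTridiagonal C⁻¹ := by
  have h' : IsMarkovUltrametric C.transpose := h.swap
  set U := eliminator C with hU
  set V := (eliminator C.transpose).transpose with hV
  have hVC : ∀ i j, j < i → (V * C) i j = 0 := by
    intro i j hij
    rw [← mul_eliminator_of_lt h' hpos hij, ← Matrix.transpose_apply (V * C), Matrix.transpose_mul]
    rfl
  have hVlow : ∀ i j, i < j → V i j = 0 := fun i j hij =>
    eliminator_of_far hij.ne' (by omega)
  have hUup : ∀ i j, j < i → U i j = 0 := fun i j hij =>
    eliminator_of_far hij.ne' (by omega)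
  have hD : V * C * U = Matrix.diagonal fun i => (V * C * U) i i := by
    ext i j
    rcases lt_trichotomy i j with hij | rfl | hij
    · rw [Matrix.diagonal_apply_ne _ hij.ne, Matrix.mul_assoc, Matrix.mul_apply]
      refine Finset.sum_eq_zero fun k _ => ?_
      rcases lt_or_ge i k with hk | hk
      · rw [hVlow i k hk, zero_mul]
      · rw [mul_eliminator_of_lt h hpos (hk.trans_lt hij), mul_zero]
    · simp
    · rw [Matrix.diagonal_apply_ne _ hij.ne', Matrix.mul_apply]
      refine Finset.sum_eq_zero fun k _ => ?_
      rcases lt_or_ge k i with hk | hk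
      · rw [hVC i k hk, zero_mul]
      · rw [hUup k j (hij.trans_le hk), mul_zero]
  set D := Matrix.diagonal fun i => (V * C * U) i i with hDdef
  have hdC := (Matrix.isUnit_iff_isUnit_det C).1 hC
  have hdU : IsUnit U.det := by rw [hU, det_eliminator]; exact isUnit_one
  have hdV : IsUnit V.det := by rw [hV, Matrix.det_transpose, det_eliminator]; exact isUnit_one
  have hdD : IsUnit D.det := by
    rw [← hD, Matrix.det_mul, Matrix.det_mul]; exact (hdV.mul hdC).mul hdU
  have hinv : C⁻¹ = U * D⁻¹ * V := by
    rw [← hD, Matrix.mul_inv_rev, Matrix.mul_inv_rev, ← Matrix.mul_assoc, Matrix.mul_nonsing_inv U hdU,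
      Matrix.one_mul, Matrix.mul_assoc, Matrix.nonsing_inv_mul V hdV, Matrix.mul_one]
  intro i j hij
  rw [hinv, hDdef, Matrix.inv_diagonal, Matrix.mul_apply]
  refine Finset.sum_eq_zero fun k _ => ?_
  rw [Matrix.mul_diagonal]
  by_cases hUk : U i k = 0
  · simp [hUk]
  by_cases hVk : V k j = 0
  · simp [hVk]
  exfalso
  have h₁ : i = k ∨ i.val + 1 = k.val := by
    by_contra! hne; exact hUk (eliminator_of_far hne.1 hne.2)
  have h₂ : j = k ∨ j.val + 1 = k.val := by
    by_contra! hne; exact hVk (eliminator_of_far hne.1 hne.2)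
  omega

end

/-! ### Infinite nonsingular Markov ultrametric matrices -/

/-- Markov ultrametric functions on `ℕ` all of whose finite sections are nonsingular. -/
structure IsRegular (c : ℕ → ℕ → ℝ) : Prop extends IsMarkovUltrametric c where
  pos : ∀ i, 0 < c i i
  adj : ∀ i, c i (i + 1) * c (i + 1) i < c i i * c (i + 1) (i + 1)

namespace IsRegular

variable {c : ℕ → ℕ → ℝ}

theorem swap (h : IsRegular c) : IsRegular (fun x y => c y x) where
  toIsMarkovUltrametric := h.toIsMarkovUltrametric.swap
  pos := h.pos
  adj i := by rw [mul_comm]; exact h.adj i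

theorem shift (h : IsRegular c) (p : ℕ) : IsRegular (fun x y => c (p + x) (p + y)) where
  toIsMarkovUltrametric := h.toIsMarkovUltrametric.comp (fun _ _ hxy => Nat.add_lt_add_left hxy p)
  pos _ := h.pos _
  adj i := h.adj (p + i)

theorem pos_upper (h : IsRegular c) {x y : ℕ} (hxy : x ≤ y)
    (hk : ∀ k, x ≤ k → k < y → 0 < c k (k + 1)) : 0 < c x y := by
  induction y, hxy using Nat.le_induction with
  | base => exact h.pos x
  | succ y hxy ih =>
    have h₁ := ih fun k hx hy => hk k hx (by omega)
    have h₂ := hk y hxy (by omega)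
    rcases hxy.eq_or_lt with rfl | hxy
    · exact h₂
    · refine pos_of_mul_pos_left ?_ (h.pos y).le
      rw [h.upper x y (y + 1) hxy (by omega)]
      exact mul_pos h₁ h₂

theorem pos_lower (h : IsRegular c) {x y : ℕ} (hxy : x ≤ y)
    (hk : ∀ k, x ≤ k → k < y → 0 < c (k + 1) k) : 0 < c y x :=
  h.swap.pos_upper hxy hk

theorem upper_eq_zero (h : IsRegular c) {x k y : ℕ} (hxk : x ≤ k) (hky : k < y)
    (hk : c k (k + 1) = 0) : c x y = 0 := by
  have h₁ : c x (k + 1) = 0 := by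
    rcases hxk.eq_or_lt with rfl | hxk
    · exact hk
    · have := h.upper x k (k + 1) hxk (by omega)
      rw [hk, mul_zero] at this
      exact (mul_eq_zero.1 this).resolve_right (h.pos k).ne'
  rcases (Nat.succ_le_of_lt hky).eq_or_lt with rfl | hky'
  · exact h₁
  · have := h.upper x (k + 1) y (by omega) hky'
    rw [h₁, zero_mul] at this
    exact (mul_eq_zero.1 this).resolve_right (h.pos _).ne'

theorem lower_eq_zero (h : IsRegular c) {x k y : ℕ} (hxk : x ≤ k) (hky : k < y)
    (hk : c (k + 1) k = 0) : c y x = 0 :=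
  h.swap.upper_eq_zero hxk hky hk

/-- Strictness spreads from adjacent indices: through `k = x + 1` the Markov property factors the
left side, and the factor belonging to `x, k` is already strictly smaller. -/
theorem mul_lt (h : IsRegular c) {x y : ℕ} (hxy : x < y) : c x y * c y x < c x x * c y y := by
  rcases (Nat.succ_le_of_lt hxy).eq_or_lt with rfl | hy
  · exact h.adj x
  · set k := x.succ with hk
    have hxk : x < k := by omega
    have h₁ := h.upper x k y hxk hy
    have h₂ := h.lower x k y hxk hy
    have h₃ : c x k * c k x < c x x * c k k := h.adj x
    have h₄ : c k y * c y k ≤ c k k * c y y :=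
      mul_le_mul (h.le_left k y) (h.le_left y k) (h.nonneg _ _) (h.pos _).le
    have h₅ : 0 ≤ c k y * c y k := mul_nonneg (h.nonneg _ _) (h.nonneg _ _)
    have hk' := h.pos k
    have hkk : 0 < c k k * c k k := mul_pos hk' hk'
    have e : (c x y * c y x) * (c k k * c k k) = (c x k * c k x) * (c k y * c y k) := by
      calc _ = (c x y * c k k) * (c y x * c k k) := by ring
        _ = _ := by rw [h₁, h₂]; ring
    refine lt_of_mul_lt_mul_right (?_ : _ < _ * (c k k * c k k)) hkk.le
    rw [e]
    calc (c x k * c k x) * (c k y * c y k) ≤ (c x k * c k x) * (c k k * c y y) :=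
          mul_le_mul_of_nonneg_left h₄ (mul_nonneg (h.nonneg _ _) (h.nonneg _ _))
      _ < (c x x * c k k) * (c k k * c y y) :=
          mul_lt_mul_of_pos_right h₃ (mul_pos hk' (h.pos y))
      _ = _ := by ring

/-- This and its mirror image give the strict monotonicity of type D parameters; they also exclude
repeated diagonal values. -/
theorem diag_lt_of_right (h : IsRegular c) {x y : ℕ} (hxy : x < y) (h₁ : c x y = c y y)
    (h₂ : c y x = c y y) : c y y < c x x := by
  have := h.mul_lt hxy
  rw [h₁, h₂] at this
  exact lt_of_mul_lt_mul_right this (h.pos y).le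

theorem diag_lt_of_left (h : IsRegular c) {x y : ℕ} (hxy : x < y) (h₁ : c x y = c x x)
    (h₂ : c y x = c x x) : c x x < c y y := by
  have := h.mul_lt hxy
  rw [h₁, h₂] at this
  exact lt_of_mul_lt_mul_left this (h.pos x).le

/-- With the middle index as apex, the two Markov identities have the same right side, so `c i l = c
l i`. The maximum condition bounds `c i j` and `c j l` by this common value, and cancelling in the
Markov identity pushes both up to `c j j`. -/
theorem all_eq_of_apex (h : IsRegular c) {i j l : ℕ} (hij : i < j) (hjl : j < l)
    (ha : IsApex c j i l) (h₁ : 0 < c i j) (h₂ : 0 < c j l) :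
    c j l = c j j ∧ c l j = c j j ∧ c i j = c j j ∧ c j i = c j j := by
  obtain ⟨e₁, e₂, h₃, h₄⟩ := ha
  have u := h.upper i j l hij hjl
  have v := h.lower i j l hij hjl
  have hj := h.pos j
  have hx : c i j ≤ c j j := h.le_right i j
  have hy : c j l ≤ c j j := h.le_left j l
  rw [← e₂, e₁] at v
  have huv : c i l = c l i := mul_right_cancel₀ hj.ne' (u.trans v.symm)
  rw [← huv, max_self, e₁] at h₄
  have ha : c i j ≤ c i l := (le_max_left _ _).trans h₄
  have hb : c j l ≤ c i l := (le_max_right _ _).trans h₄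
  have e₃ : c j l = c j j := by
    refine le_antisymm hy (le_of_mul_le_mul_left ?_ h₁)
    rw [← u]; exact mul_le_mul_of_nonneg_right ha hj.le
  have e₄ : c i j = c j j := by
    refine le_antisymm hx (le_of_mul_le_mul_right ?_ h₂)
    rw [← u, mul_comm]; exact mul_le_mul_of_nonneg_right hb hj.le
  exact ⟨e₃, by rw [← e₂, e₄], e₄, by rw [e₁, e₃]⟩

/-- An outer apex makes `c i l` equal to `c i j` or to `c j l`, which cancels from the Markov
identity. The next three lemmas refine this by the signs below the diagonal, which may exclude one
of the outer apexes. -/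
theorem right_or_left (h : IsRegular c) {i j l : ℕ} (hij : i < j) (hjl : j < l)
    (h₁ : 0 < c i j) (h₂ : 0 < c j l) : c i j = c j j ∨ c j l = c j j := by
  have u := h.upper i j l hij hjl
  rcases h.apex i j l hij hjl with ha | ha | ha
  · rw [← ha.1] at u
    exact Or.inr (mul_left_cancel₀ h₁.ne' u).symm
  · exact Or.inr (h.all_eq_of_apex hij hjl ha h₁ h₂).1
  · rw [ha.2.1, mul_comm] at u
    exact Or.inl (mul_right_cancel₀ h₂.ne' u).symm

theorem left_of_zero_pos (h : IsRegular c) {i j l : ℕ} (hij : i < j) (hjl : j < l)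
    (h₁ : 0 < c i j) (h₂ : 0 < c j l) (h₃ : c j i = 0) (h₄ : 0 < c l j) : c j l = c j j := by
  have u := h.upper i j l hij hjl
  have v := h.lower i j l hij hjl
  rcases h.apex i j l hij hjl with ha | ha | ha
  · rw [← ha.1] at u
    exact (mul_left_cancel₀ h₁.ne' u).symm
  · exact (h.all_eq_of_apex hij hjl ha h₁ h₂).1
  · rw [h₃, mul_zero, ha.1] at v
    exact absurd v (mul_pos h₄ (h.pos j)).ne'

theorem right_of_pos_zero (h : IsRegular c) {i j l : ℕ} (hij : i < j) (hjl : j < l)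
    (h₁ : 0 < c i j) (h₂ : 0 < c j l) (h₃ : 0 < c j i) (h₄ : c l j = 0) : c i j = c j j := by
  have u := h.upper i j l hij hjl
  have v := h.lower i j l hij hjl
  rcases h.apex i j l hij hjl with ha | ha | ha
  · rw [h₄, zero_mul, ← ha.2.1] at v
    exact absurd v (mul_pos h₃ (h.pos j)).ne'
  · exact (h.all_eq_of_apex hij hjl ha h₁ h₂).2.2.1
  · rw [ha.2.1, mul_comm] at u
    exact (mul_right_cancel₀ h₂.ne' u).symm

theorem left_or_right_of_pos (h : IsRegular c) {i j l : ℕ} (hij : i < j) (hjl : j < l)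
    (h₁ : 0 < c i j) (h₂ : 0 < c j l) (h₃ : 0 < c j i) (h₄ : 0 < c l j) :
    (c i j = c j j ∧ c j i = c j j) ∨ (c j l = c j j ∧ c l j = c j j) := by
  have u := h.upper i j l hij hjl
  have v := h.lower i j l hij hjl
  rcases h.apex i j l hij hjl with ha | ha | ha
  · rw [← ha.1] at u
    rw [← ha.2.1, mul_comm] at v
    exact Or.inr ⟨(mul_left_cancel₀ h₁.ne' u).symm, (mul_right_cancel₀ h₃.ne' v).symm⟩
  · exact Or.inl (h.all_eq_of_apex hij hjl ha h₁ h₂).2.2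
  · rw [ha.2.1, mul_comm] at u
    rw [ha.1] at v
    exact Or.inl ⟨(mul_right_cancel₀ h₂.ne' u).symm, (mul_left_cancel₀ h₄.ne' v).symm⟩

/-- The Markov property gives `c i l = c l i = 0`, and then each of the three apexes contradicts the
positivity of `c j l` or of `c j i`. -/
theorem not_mixed (h : IsRegular c) {i j l : ℕ} (hij : i < j) (hjl : j < l)
    (h₁ : c i j = 0) (h₂ : 0 < c j l) (h₃ : 0 < c j i) (h₄ : c l j = 0) : False := by
  have u := h.upper i j l hij hjl
  have v := h.lower i j l hij hjl
  have hj := (h.pos j).ne'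
  rw [h₁, zero_mul] at u
  rw [h₄, zero_mul] at v
  have u := (mul_eq_zero.1 u).resolve_right hj
  have v := (mul_eq_zero.1 v).resolve_right hj
  rcases h.apex i j l hij hjl with ha | ha | ha
  · exact h₃.ne' (ha.2.1.trans v)
  · have := ha.2.2.2
    rw [u, v, max_self, ha.1] at this
    exact h₂.not_ge ((le_max_right _ _).trans this)
  · exact h₂.ne' (ha.2.1.symm.trans u)

end IsRegular

theorem exists_greatest_of_le {P : ℕ → Prop} {a b : ℕ} (hab : a ≤ b) (ha : P a) :
    ∃ z, a ≤ z ∧ z ≤ b ∧ P z ∧ ∀ w, z < w → w ≤ b → ¬ P w := by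
  induction b, hab using Nat.le_induction with
  | base => exact ⟨a, le_rfl, le_rfl, ha, fun w _ _ => by omega⟩
  | succ b hab ih =>
    by_cases hb : P (b + 1)
    · exact ⟨b + 1, by omega, le_rfl, hb, fun w _ _ => by omega⟩
    · obtain ⟨z, h₁, h₂, h₃, h₄⟩ := ih
      refine ⟨z, h₁, by omega, h₃, fun w hw hwb => ?_⟩
      rcases hwb.eq_or_lt with rfl | hwb
      · exact hb
      · exact h₄ w hw (by omega)

/-! ### Shape of irreducible segments -/

namespace IsRegular

variable {c : ℕ → ℕ → ℝ}

/-- A positive regular function is a cyclops on every initial segment. -/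
theorem exists_eye (h : IsRegular c) {k : ℕ} (hk : 1 ≤ k)
    (hpos : ∀ x y, x < k → y < k → 0 < c x y) :
    ∃ z, 1 ≤ z ∧ z ≤ k ∧
      (∀ x y, x ≤ y → y < z → c x y = c y y ∧ c y x = c y y) ∧
      (∀ x y, z ≤ x → x ≤ y → y < k → c x y = c x x ∧ c y x = c x x) ∧
      (∀ x y, x < z → z ≤ y → y < k → c x y = c (z - 1) z ∧ c y x = c z (z - 1)) := by
  -- The eye `z` is the length of the longest descending initial segment; length one always
  -- qualifies.
  obtain ⟨z, hz₁, hzk, hz, hmax⟩ := exists_greatest_of_le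
    (P := fun z => ∀ x y, x ≤ y → y < z → c x y = c y y ∧ c y x = c y y) hk
    (fun x y hxy hy => by
      obtain rfl : x = y := by omega
      exact ⟨rfl, rfl⟩)
  have hright : ∀ x y, z ≤ x → x ≤ y → y < k → c x y = c x x ∧ c y x = c x x := by
    intro x y hzx hxy hyk
    rcases hxy.eq_or_lt with rfl | hxy
    · exact ⟨rfl, rfl⟩
    have hn := hmax (z + 1) (by omega) (by omega)
    push Not at hn
    obtain ⟨a, b, hab, hbz, hne⟩ := hn
    have hbz' : b = z := by
      by_contra hb
      have := hz a b hab (by omega)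
      exact hne this.1 this.2
    subst hbz'
    have haz : a < b := by
      refine hab.lt_of_ne ?_
      rintro rfl
      exact hne rfl rfl
    -- Descent fails at the pair `a < b`, where `b` is the eye, so of the two alternatives at the
    -- middle index `b` only the ascending one survives.
    have key : ∀ l, b < l → l < k → c b l = c b b ∧ c l b = c b b := by
      intro l hbl hlk
      rcases h.left_or_right_of_pos haz hbl (hpos _ _ (by omega) (by omega))
        (hpos _ _ (by omega) (by omega)) (hpos _ _ (by omega) (by omega))
        (hpos _ _ (by omega) (by omega)) with hl | hl
      · exact absurd hl.2 (hne hl.1)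
      · exact hl
    rcases hzx.eq_or_lt with rfl | hzx
    · exact key y hxy hyk
    rcases h.left_or_right_of_pos hzx hxy (hpos _ _ (by omega) (by omega))
        (hpos _ _ (by omega) (by omega)) (hpos _ _ (by omega) (by omega))
        (hpos _ _ (by omega) (by omega)) with hl | hl
    -- Descent from `z` to `x`, together with the ascent just found, would make their diagonal
    -- values equal.
    · have h₁ := key x hzx (by omega)
      have h₂ := h.diag_lt_of_left hzx h₁.1 h₁.2
      rw [← hl.1, h₁.1] at h₂
      exact absurd h₂ (lt_irrefl _)
    · exact hl
  refine ⟨z, hz₁, hzk, hz, hright, fun x y hxz hzy hyk => ?_⟩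
  have hz' := h.pos z
  have hz1 := h.pos (z - 1)
  have e₁ : c x y = c (z - 1) y ∧ c y x = c y (z - 1) := by
    rcases (show x ≤ z - 1 by omega).eq_or_lt with rfl | hx
    · exact ⟨rfl, rfl⟩
    · have u := h.upper x (z - 1) y hx (by omega)
      have v := h.lower x (z - 1) y hx (by omega)
      have hd := hz x (z - 1) hx.le (by omega)
      rw [hd.1, mul_comm] at u
      rw [hd.2] at v
      exact ⟨mul_left_cancel₀ hz1.ne' u, mul_right_cancel₀ hz1.ne' v⟩
  rw [e₁.1, e₁.2]
  rcases hzy.eq_or_lt with rfl | hzy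
  · exact ⟨rfl, rfl⟩
  · have u := h.upper (z - 1) z y (by omega) hzy
    have v := h.lower (z - 1) z y (by omega) hzy
    have hd := hright z y le_rfl hzy.le hyk
    rw [hd.1] at u
    rw [hd.2, mul_comm] at v
    exact ⟨mul_right_cancel₀ hz'.ne' u, mul_left_cancel₀ hz'.ne' v⟩

/-- A regular function that is positive above the diagonal, but not below, is the smaller diagonal
value on both sides of some position. -/
theorem exists_split (h : IsRegular c) {n : ℕ} (hpos : ∀ x y, x ≤ y → y < n → 0 < c x y)
    (hzero : ∃ k, k + 1 < n ∧ c (k + 1) k = 0) :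
    ∃ k, k + 1 < n ∧ c (k + 1) k = 0 ∧ (∀ x y, x ≤ y → y ≤ k → c x y = c y y) ∧
      (∀ x y, k < x → x ≤ y → y < n → c x y = c x x) := by
  classical
  have lower_pos : ∀ {a b : ℕ}, (∀ k, a ≤ k → k < b → ¬ (k + 1 < n ∧ c (k + 1) k = 0)) → b < n →
      ∀ x y, a ≤ x → x ≤ y → y ≤ b → 0 < c y x := by
    intro a b hab hbn x y hax hxy hyb
    refine h.pos_lower hxy fun k hxk hky => (h.nonneg _ _).lt_of_ne' fun h0 => ?_
    exact hab k (by omega) (by omega) ⟨by omega, h0⟩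
  -- Up to the first zero below the diagonal the entries descend, by `right_of_pos_zero` with `k₀ +
  -- 1` as third index. The split is then the last zero with this property.
  obtain ⟨k₀, ⟨hk₀n, hk₀⟩, hmin⟩ : ∃ k₀, (k₀ + 1 < n ∧ c (k₀ + 1) k₀ = 0) ∧
      ∀ k < k₀, ¬ (k + 1 < n ∧ c (k + 1) k = 0) :=
    ⟨Nat.find hzero, Nat.find_spec hzero, fun k hk => Nat.find_min hzero hk⟩
  have start : ∀ x y, x ≤ y → y ≤ k₀ → c x y = c y y := by
    intro x y hxy hyk
    rcases hxy.eq_or_lt with rfl | hxy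
    · rfl
    exact h.right_of_pos_zero hxy (Nat.lt_succ_of_le hyk) (hpos _ _ hxy.le (by omega))
      (hpos _ _ (by omega) (by omega))
      (lower_pos (a := 0) (fun k _ hk => hmin k hk) (by omega) x y (by omega) hxy.le hyk)
      (h.lower_eq_zero hyk (by omega) hk₀)
  obtain ⟨k, -, hkn, ⟨hk1, hk, hdesc⟩, hmax⟩ := exists_greatest_of_le
    (P := fun k => k + 1 < n ∧ c (k + 1) k = 0 ∧ ∀ x y, x ≤ y → y ≤ k → c x y = c y y)
    (show k₀ ≤ n by omega) ⟨hk₀n, hk₀, start⟩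
  refine ⟨k, hk1, hk, hdesc, fun x y hkx hxy hyn => ?_⟩
  rcases hxy.eq_or_lt with rfl | hxy
  · rfl
  by_cases hnext : ∃ k', (k < k' ∧ k' + 1 < n) ∧ c (k' + 1) k' = 0
  · obtain ⟨k', ⟨⟨hkk', hk'n⟩, hk'⟩, hmin'⟩ : ∃ k', ((k < k' ∧ k' + 1 < n) ∧ c (k' + 1) k' = 0) ∧
        ∀ j < k', ¬ ((k < j ∧ j + 1 < n) ∧ c (j + 1) j = 0) :=
      ⟨Nat.find hnext, Nat.find_spec hnext, fun k hk => Nat.find_min hnext hk⟩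
    -- By maximality descent fails before the next zero `k'`, at some pair `a < b ≤ k'`. It does
    -- hold for pairs up to `k` and for pairs strictly after `k`, so `a ≤ k < b`.
    have hn := hmax k' hkk' (by omega)
    push Not at hn
    obtain ⟨a, b, hab, hbk', hne⟩ := hn hk'n hk'
    have hab : a < b := by
      refine hab.lt_of_ne ?_
      rintro rfl
      exact hne rfl
    have inner : ∀ a, k < a → a < b → c a b = c b b := fun a hka hab =>
      h.right_of_pos_zero hab (Nat.lt_succ_of_le hbk') (hpos _ _ hab.le (by omega))
        (hpos _ _ (by omega) (by omega))
        (lower_pos (a := k + 1) (fun j hj hjk hj' => hmin' j hjk ⟨⟨by omega, hj'.1⟩, hj'.2⟩)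
          (by omega) a b (by omega) hab.le hbk')
        (h.lower_eq_zero hbk' (by omega) hk')
    have hkb : k < b := by
      by_contra hkb
      exact hne (hdesc a b hab.le (by omega))
    have hak : a ≤ k := by
      by_contra hak
      exact hne (inner a (by omega) hab)
    have hax : a < x := by omega
    -- The first alternative `c a x = c x x` would, by the Markov property among `a`, `b`, `x`,
    -- yield `c a b = c b b`.
    rcases h.right_or_left hax hxy (hpos _ _ hax.le (by omega)) (hpos _ _ hxy.le hyn) with hx | hx
    · exfalso
      rcases lt_trichotomy x b with hxb | rfl | hxb
      · have u := h.upper a x b hax hxb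
        rw [hx, inner x hkx hxb, mul_comm] at u
        exact hne (mul_left_cancel₀ (h.pos x).ne' u)
      · exact hne hx
      · have u := h.upper a b x hab hxb
        rw [hx] at u
        have h₁ := h.le_right b x
        have h₂ := h.le_right a b
        refine hne (le_antisymm h₂ ?_)
        have : c x x * c b b ≤ c x x * c a b := by
          rw [u, mul_comm]; exact mul_le_mul_of_nonneg_right h₁ (h.nonneg _ _)
        exact le_of_mul_le_mul_left this (h.pos x)
    · exact hx
  -- No zero follows `k`: the entries below the diagonal after it are positive, while `c x k = 0`.
  · refine h.left_of_zero_pos hkx hxy (hpos _ _ hkx.le (by omega)) (hpos _ _ hxy.le hyn)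
      (h.lower_eq_zero le_rfl hkx hk) ?_
    refine lower_pos (a := k + 1) (b := n - 1) (fun j hj hjn hj' => hnext ⟨j, ⟨by omega, hj'.1⟩, hj'.2⟩)
      (by omega) x y (by omega) hxy.le (by omega)

/-- In an irreducible segment, zeros next to the diagonal are all on the same side. -/
theorem pos_upper_or_lower (h : IsRegular c) {n : ℕ}
    (hirr : ∀ k, k + 1 < n → c k (k + 1) ≠ 0 ∨ c (k + 1) k ≠ 0) :
    (∀ k, k + 1 < n → 0 < c k (k + 1)) ∨ (∀ k, k + 1 < n → 0 < c (k + 1) k) := by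
  have key : ∀ {c : ℕ → ℕ → ℝ}, IsRegular c →
      (∀ k, k + 1 < n → c k (k + 1) ≠ 0 ∨ c (k + 1) k ≠ 0) →
      ∀ i j, i < j → j + 1 < n → c i (i + 1) = 0 → c (j + 1) j = 0 → False := by
    clear! c
    intro c h hirr i₀ j hij hjn hi₀ hj
    -- Taking the last zero above the diagonal at or before `j` makes the upper entries from `i + 1`
    -- to `j + 1` positive, so the triple `i`, `i + 1`, `j + 1` falls under `not_mixed`.
    obtain ⟨i, -, hij', hi, hmax⟩ := exists_greatest_of_le (P := fun i => c i (i + 1) = 0)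
      (show i₀ ≤ j by omega) hi₀
    have hij : i < j := by
      refine hij'.lt_of_ne ?_
      rintro rfl
      exact (hirr i hjn).elim (fun h => h hi) (fun h => h hj)
    refine h.not_mixed (i := i) (j := i + 1) (l := j + 1) (by omega) (by omega) hi ?_ ?_ ?_
    · refine h.pos_upper (by omega) fun k hik hkj => (h.nonneg _ _).lt_of_ne' (hmax k (by omega) (by omega))
    · exact (h.nonneg _ _).lt_of_ne' ((hirr i (by omega)).resolve_left fun h => h hi)
    · exact h.lower_eq_zero (by omega) (by omega) hj
  by_contra! hne
  obtain ⟨⟨i, hin, hi⟩, ⟨j, hjn, hj⟩⟩ := hne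
  have hi := le_antisymm hi (h.nonneg _ _)
  have hj := le_antisymm hj (h.nonneg _ _)
  rcases lt_trichotomy i j with hij | rfl | hij
  · exact key h hirr i j hij hjn hi hj
  · exact (hirr i hin).elim (fun h => h hi) (fun h => h hj)
  · exact key h.swap (fun k hk => (hirr k hk).symm) j i hij hin hj hi

end IsRegular

/-! ### Finite sections -/

/-- The `k × k` matrix with the entries `c i j`. -/
def truncate (c : ℕ → ℕ → ℝ) (k : ℕ) : Matrix (Fin k) (Fin k) ℝ :=
  Matrix.of fun i j => c i j

@[simp]
theorem truncate_apply (c : ℕ → ℕ → ℝ) {k : ℕ} (i j : Fin k) : truncate c k i j = c i j := rfl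

namespace IsRegular

variable {c : ℕ → ℕ → ℝ}

theorem isUnit_truncate (h : IsRegular c) (k : ℕ) : IsUnit (truncate c k) := by
  refine (isUnit_iff_adjacent (h.toIsMarkovUltrametric.comp (e := Fin.val) fun _ _ hxy => hxy)
    fun i => h.pos i).2 fun i j hij => ?_
  simp only [← hij]
  exact h.adj i

theorem isPositiveCyclops_truncate (h : IsRegular c) {k : ℕ} (hk : 1 ≤ k)
    (hpos : ∀ x y, x < k → y < k → 0 < c x y) : IsPositiveCyclops (truncate c k) := by
  obtain ⟨z, hz₁, hzk, hleft, hright, hcross⟩ := h.exists_eye hk hpos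
  obtain ⟨b₁, b₂, hb₁, hb₂, hle, hb⟩ : ∃ b₁ b₂ : ℝ, 0 < b₁ ∧ 0 < b₂ ∧
      (∀ i < k, i + 1 = z ∨ i = z → max b₁ b₂ ≤ c i i) ∧
      ∀ x y, x < z → z ≤ y → y < k → c x y = b₁ ∧ c y x = b₂ := by
    rcases hzk.eq_or_lt with rfl | hzk
    -- The eye fills the whole matrix, so `b₁` and `b₂` occur nowhere; the last parameter satisfies
    -- the bound.
    · refine ⟨c (z - 1) (z - 1), c (z - 1) (z - 1), h.pos _, h.pos _, ?_, by omega⟩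
      intro i hi hiz
      obtain rfl : i = z - 1 := by omega
      simp
    · refine ⟨c (z - 1) z, c z (z - 1), hpos _ _ (by omega) hzk, hpos _ _ hzk (by omega), ?_, hcross⟩
      rintro i hi (hiz | rfl)
      · obtain rfl : i = z - 1 := by omega
        exact max_le (h.le_left _ _) (h.le_right _ _)
      · exact max_le (h.le_right _ _) (h.le_left _ _)
  refine ⟨z, fun i => c i i, b₁, b₂, hz₁, hzk, ⟨k - z, by omega, truncate c z,
    truncate (fun x y => c (z + x) (z + y)) (k - z), ⟨?_, ?_⟩, ⟨?_, ?_⟩, ?_⟩,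
    fun i hi => hle i i.2 hi, lt_min hb₁ hb₂⟩
  · intro i j hij
    simp only [Fin.val_cast, Fin.val_castAdd]
    have hij' : (j.rev : ℕ) < i.rev := Fin.rev_lt_rev.2 hij
    have := hleft _ _ hij'.le i.rev.2
    exact h.diag_lt_of_right hij' this.1 this.2
  · intro i j
    simp only [Matrix.submatrix_apply, truncate_apply, Fin.val_cast, Fin.val_castAdd]
    split_ifs with hij
    · exact (hleft _ _ (Fin.rev_le_rev.2 hij) i.rev.2).2
    · exact (hleft _ _ (Fin.rev_le_rev.2 (not_le.1 hij).le) j.rev.2).1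
  · intro i j hij
    simp only [Fin.val_cast, Fin.val_natAdd]
    have hij' : z + (i : ℕ) < z + j := Nat.add_lt_add_left hij z
    have := hright _ _ (by omega) hij'.le (by omega)
    exact h.diag_lt_of_left hij' this.1 this.2
  · intro i j
    simp only [truncate_apply, Fin.val_cast, Fin.val_natAdd]
    split_ifs with hij
    · exact (hright _ _ (by omega) (Nat.add_le_add_left hij z) (by omega)).1
    · exact (hright _ _ (by omega) (Nat.add_le_add_left (not_le.1 hij).le z) (by omega)).2
  · ext (i | i) (j | j)
    · simp
    · simpa using (hb i (z + j) i.2 (by omega) (by omega)).1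
    · simpa using (hb j (z + i) j.2 (by omega) (by omega)).2
    · simp

theorem isGCyclops_truncate (h : IsRegular c) {k : ℕ} (hk : 1 ≤ k)
    (hpos : ∀ x y, x < k → y < k → 0 < c x y) : IsGCyclops (truncate c k) :=
  ⟨h.isUnit_truncate k, h.isPositiveCyclops_truncate hk hpos⟩

end IsRegular

/-! ### Partitions into consecutive blocks -/

theorem sum_castLE_eq_offset {m : ℕ} (d : Fin m → ℕ) {o : ℕ → ℕ} (h0 : o 0 = 0)
    (ho : ∀ s : Fin m, o (s + 1) = o s + d s) (k : ℕ) (hk : k ≤ m) :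
    ∑ i : Fin k, d (Fin.castLE hk i) = o k := by
  induction k with
  | zero => simp [h0]
  | succ k ih =>
    rw [Fin.sum_univ_castSucc, ho ⟨k, hk⟩, ← ih (by omega)]
    rfl

theorem blockIndex_val {m n : ℕ} {d : Fin m → ℕ} (h : ∑ s, d s = n) {o : ℕ → ℕ} (h0 : o 0 = 0)
    (ho : ∀ s : Fin m, o (s + 1) = o s + d s) (x : (s : Fin m) × Fin (d s)) :
    (blockIndex d h x : ℕ) = o x.1 + x.2 := by
  rw [blockIndex, Fin.val_cast, finSigmaFinEquiv_apply, sum_castLE_eq_offset d h0 ho]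

theorem exists_offset {m : ℕ} (d : Fin m → ℕ) :
    ∃ o : ℕ → ℕ, o 0 = 0 ∧ ∀ s : Fin m, o (s + 1) = o s + d s := by
  refine ⟨fun k => ∑ t ∈ Finset.range k, if ht : t < m then d ⟨t, ht⟩ else 0, by simp, fun s => ?_⟩
  simp [Finset.sum_range_succ]

/-- The numbers `o 0, …, o m` cut `{0, …, n - 1}` into nonempty consecutive blocks. -/
structure IsPartition (o : ℕ → ℕ) (m n : ℕ) : Prop where
  zero : o 0 = 0
  last : o m = n
  lt_succ : ∀ s < m, o s < o (s + 1)

namespace IsPartition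

variable {o : ℕ → ℕ} {m n : ℕ}

theorem lt (h : IsPartition o m n) {s t : ℕ} (hst : s < t) (ht : t ≤ m) : o s < o t := by
  induction t, hst using Nat.le_induction with
  | base => exact h.lt_succ s ht
  | succ t _ ih => exact (ih (by omega)).trans (h.lt_succ t ht)

theorem le (h : IsPartition o m n) {s t : ℕ} (hst : s ≤ t) (ht : t ≤ m) : o s ≤ o t := by
  rcases hst.eq_or_lt with rfl | hst
  · exact le_rfl
  · exact (h.lt hst ht).le

theorem exists_block (h : IsPartition o m n) {x : ℕ} (hx : x < n) :
    ∃ s < m, o s ≤ x ∧ x < o (s + 1) := by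
  obtain ⟨s, -, hsm, hs, hmax⟩ := exists_greatest_of_le (P := fun s => o s ≤ x) (Nat.zero_le m)
    (by rw [h.zero]; exact Nat.zero_le x)
  have hsm' : s < m := by
    refine hsm.lt_of_ne ?_
    rintro rfl
    have := h.last
    omega
  exact ⟨s, hsm', hs, not_le.1 (hmax (s + 1) (by omega) hsm')⟩

theorem size_spec (h : IsPartition o m n) (s : Fin m) :
    o (s + 1) = o s + (o (s + 1) - o s) := by
  have := h.lt_succ s s.2
  omega

theorem sum_size (h : IsPartition o m n) : ∑ s : Fin m, (o (s + 1) - o s) = n := by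
  have := sum_castLE_eq_offset (fun s : Fin m => o (s + 1) - o s) h.zero h.size_spec m le_rfl
  rw [h.last] at this
  exact this

end IsPartition

/-- By induction on `n`, the new position `n` opens a block if it is a cut and extends the last
block otherwise. Position `0` starts a block whether or not it is a cut. -/
theorem exists_isPartition (cut : ℕ → Prop) (n : ℕ) :
    ∃ (m : ℕ) (o : ℕ → ℕ), IsPartition o m n ∧ (∀ s, 0 < s → s < m → cut (o s)) ∧
      ∀ s < m, ∀ x, o s < x → x < o (s + 1) → ¬ cut x := by
  induction n with
  | zero => exact ⟨0, fun _ => 0, ⟨rfl, rfl, by omega⟩, by omega, by omega⟩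
  | succ n ih =>
    obtain ⟨m, o, h, hcut, hncut⟩ := ih
    rcases Nat.eq_zero_or_pos m with rfl | hm
    · have hn : n = 0 := by rw [← h.last, h.zero]
      subst hn
      exact ⟨1, id, ⟨rfl, rfl, by simp⟩, by omega, fun s _ x h₁ h₂ => by simp at h₁ h₂; omega⟩
    have hon := h.last
    by_cases hc : cut n
    · refine ⟨m + 1, fun s => if s ≤ m then o s else n + 1, ⟨by simp [h.zero], by simp, ?_⟩, ?_, ?_⟩
      · intro s hs
        rcases (Nat.lt_succ_iff.1 hs).eq_or_lt with rfl | hs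
        · simp [hon]
        · have := h.lt_succ s hs
          simpa [hs.le, Nat.succ_le_of_lt hs] using this
      · intro s hs₀ hs
        rcases (Nat.lt_succ_iff.1 hs).eq_or_lt with rfl | hs
        · simpa [hon] using hc
        · simpa [hs.le] using hcut s hs₀ hs
      · intro s hs x hx₁ hx₂
        rcases (Nat.lt_succ_iff.1 hs).eq_or_lt with rfl | hs
        · simp at hx₁ hx₂; omega
        · simp only [hs.le, Nat.succ_le_of_lt hs, if_true] at hx₁ hx₂
          exact hncut s hs x hx₁ hx₂
    · refine ⟨m, fun s => if s = m then n + 1 else o s, ⟨by simp [hm.ne, h.zero], by simp, ?_⟩, ?_, ?_⟩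
      · intro s hs
        have := h.lt_succ s hs
        by_cases hs' : s + 1 = m
        · subst hs'; simp; omega
        · simpa [hs.ne, hs'] using this
      · intro s hs₀ hs
        simpa [hs.ne] using hcut s hs₀ hs
      · intro s hs x hx₁ hx₂
        simp only [hs.ne, if_false] at hx₁
        by_cases hs' : s + 1 = m
        · simp only [hs', if_true] at hx₂
          rcases (Nat.lt_succ_iff.1 hx₂).eq_or_lt with rfl | hx₂
          · exact hc
          · exact hncut s hs x hx₁ (by rw [hs', hon]; exact hx₂)
        · simp only [hs', if_false] at hx₂
          exact hncut s hs x hx₁ hx₂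

theorem block_truncate_apply {m n : ℕ} {d : Fin m → ℕ} (h : ∑ s, d s = n) {o : ℕ → ℕ}
    (h0 : o 0 = 0) (ho : ∀ s : Fin m, o (s + 1) = o s + d s) (c : ℕ → ℕ → ℝ) (s t : Fin m)
    (i : Fin (d s)) (j : Fin (d t)) :
    block d h (truncate c n) s t i j = c (o s + i) (o t + j) := by
  simp [block, blockIndex_val h h0 ho]

/-! ### The nested block form of a segment with zeros below the diagonal -/

theorem IsRegular.isNestedUpper_truncate {c : ℕ → ℕ → ℝ} (h : IsRegular c) {n : ℕ}
    (hpos : ∀ x y, x ≤ y → y < n → 0 < c x y) (hzero : ∃ k, k + 1 < n ∧ c (k + 1) k = 0) :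
    IsNestedUpper (truncate c n) := by
  obtain ⟨k₀, hk₀n, hk₀, hdesc, hasc⟩ := h.exists_split hpos hzero
  obtain ⟨m, o, ho, hcut, hncut⟩ := exists_isPartition (fun x => c x (x - 1) = 0) n
  -- The split lies at a zero, hence at a block boundary; `q` counts the blocks before it.
  obtain ⟨q, hqm, hq⟩ : ∃ q < m, o q = k₀ + 1 := by
    obtain ⟨q, hqm, h₁, h₂⟩ := ho.exists_block hk₀n
    refine ⟨q, hqm, h₁.antisymm (not_lt.1 fun hlt => ?_)⟩
    exact hncut q hqm _ hlt h₂ hk₀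
  have hq₁ : 1 ≤ q := by
    by_contra hq₀
    obtain rfl : q = 0 := by omega
    rw [ho.zero] at hq
    omega
  have below : ∀ {s t x y}, s < t → t < m → x < o (s + 1) → o t ≤ y → c y x = 0 := by
    intro s t x y hst ht hx hy
    have h₁ : o (s + 1) ≤ o t := ho.le hst ht.le
    have h₂ : 0 < o t := by omega
    refine h.lower_eq_zero (k := o t - 1) (by omega) (by omega) ?_
    rw [Nat.sub_add_cancel h₂]
    exact hcut t (by omega) ht
  have inside : ∀ {s x y}, s < m → o s ≤ x → x ≤ y → y < o (s + 1) → 0 < c y x := by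
    intro s x y hs hx hxy hy
    refine h.pos_lower hxy fun k hxk hky => (h.nonneg _ _).lt_of_ne' fun h0 => ?_
    exact hncut s hs (k + 1) (by omega) (by omega) h0
  have hom : ∀ {s}, s ≤ m → o s ≤ n := fun {s} hs => by
    have := ho.le hs le_rfl
    rwa [ho.last] at this
  -- A middle block has zeros below the diagonal on both sides. The index just before it forces
  -- ascent and the index just after it forces descent, so its upper triangle is constant.
  have middle : ∀ {s x y}, 0 < s → s + 1 < m → o s ≤ x → x ≤ y → y < o (s + 1) →
      c x y = c x x ∧ c x y = c y y := by
    intro s x y hs₀ hsm hx hxy hy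
    rcases hxy.eq_or_lt with rfl | hxy
    · exact ⟨rfl, rfl⟩
    have hy' : o (s + 1) < n := by
      have := ho.lt hsm le_rfl
      rwa [ho.last] at this
    have hs' : 0 < o s := by
      have := ho.lt hs₀ (by omega)
      omega
    have hp := inside (by omega) hx hxy.le hy
    have hs1 : o s - 1 < o (s - 1 + 1) := by rw [Nat.sub_add_cancel hs₀]; omega
    refine ⟨?_, ?_⟩
    · exact h.left_of_zero_pos (i := o s - 1) (by omega) hxy (hpos _ _ (by omega) (by omega))
        (hpos _ _ hxy.le (by omega)) (below (s := s - 1) (t := s) (by omega) (by omega) hs1 hx) hp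
    · exact h.right_of_pos_zero (l := o (s + 1)) hxy hy (hpos _ _ hxy.le (by omega))
        (hpos _ _ hy.le hy') hp (below (Nat.lt_succ_self s) hsm hy le_rfl)
  -- The Markov property through `k₀` and then `k₀ + 1`, with descent on the left and ascent on the
  -- right.
  have cross : ∀ {x y}, x ≤ k₀ → k₀ < y → y < n → c x y = c k₀ (k₀ + 1) := by
    intro x y hx hy hyn
    have e₁ : c x y = c k₀ y := by
      rcases hx.eq_or_lt with rfl | hx
      · rfl
      · have u := h.upper x k₀ y hx hy
        rw [hdesc x k₀ hx.le le_rfl, mul_comm] at u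
        exact mul_left_cancel₀ (h.pos _).ne' u
    rw [e₁]
    rcases (Nat.succ_le_of_lt hy).eq_or_lt with rfl | hy
    · rfl
    · have u := h.upper k₀ (k₀ + 1) y (by omega) hy
      rw [hasc (k₀ + 1) y (by omega) (by omega) hyn] at u
      exact mul_right_cancel₀ (h.pos _).ne' u
  -- Each block is represented by its index nearest the split: the last one when descending, the
  -- first one when ascending. This matches the constant last column of the first block and the
  -- constant first row of the last block, so that `f s t = c (r s) (r t)` serves throughout.
  let r : ℕ → ℕ := fun s => if s < q then o (s + 1) - 1 else o s
  have hr : ∀ {s}, s < m → o s ≤ r s ∧ r s < o (s + 1) := by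
    intro s hs
    have := ho.lt_succ s hs
    simp only [r]
    split_ifs <;> omega
  have hr₁ : ∀ {s}, s < q → r s ≤ k₀ := by
    intro s hs
    have h₁ := (hr (hs.trans hqm)).2
    have h₂ : o (s + 1) ≤ o q := ho.le hs hqm.le
    omega
  have hr₂ : ∀ {s}, q ≤ s → s < m → k₀ < r s ∧ r s < n := by
    intro s hs hsm
    have h₁ := hr hsm
    have h₂ : o q ≤ o s := ho.le hs hsm.le
    have h₃ : o (s + 1) ≤ n := hom hsm
    omega
  have hrm : ∀ {s t}, s < t → t < m → r s < r t := by
    intro s t hst ht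
    have h₁ := hr ht
    have h₂ := hr (hst.trans ht)
    have h₃ : o (s + 1) ≤ o t := ho.le hst ht.le
    omega
  have hrle : ∀ {s t : Fin m}, s ≤ t → r s ≤ r t := fun {s t} hst => by
    rcases hst.eq_or_lt with rfl | hst
    · exact le_rfl
    · exact (hrm hst t.2).le
  have flat : ∀ {s t x y}, s < t → t < m → o s ≤ x → x < o (s + 1) → o t ≤ y → y < o (t + 1) →
      c x y = c (r s) (r t) := by
    intro s t x y hst ht hx₁ hx₂ hy₁ hy₂
    have h₁ : o (s + 1) ≤ o t := ho.le hst ht.le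
    have hyn : o (t + 1) ≤ n := hom ht
    have hrt := hr ht
    rcases lt_or_ge t q with htq | htq
    · have h₂ : o (t + 1) ≤ o q := ho.le htq hqm.le
      rw [hdesc x y (by omega) (by omega), hdesc _ _ (hrm hst ht).le (hr₁ htq)]
      rcases le_total y (r t) with hy | hy
      · have := middle (s := t) (by omega) (by omega) hy₁ hy hrt.2
        rw [← this.1, this.2]
      · have := middle (s := t) (by omega) (by omega) hrt.1 hy hy₂
        rw [← this.2, this.1]
    · rcases lt_or_ge s q with hsq | hsq
      · have h₂ : o (s + 1) ≤ o q := ho.le hsq hqm.le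
        have h₃ : o q ≤ o t := ho.le htq ht.le
        rw [cross (by omega) (by omega) (by omega), cross (hr₁ hsq) (hr₂ htq ht).1 (hr₂ htq ht).2]
      · have h₂ : o q ≤ o s := ho.le hsq (by omega)
        have hrs := hr (hst.trans ht)
        rw [hasc x y (by omega) (by omega) (by omega), hasc _ _ (hr₂ hsq (by omega)).1
          (hrm hst ht).le (hr₂ htq ht).2]
        rcases le_total x (r s) with hx | hx
        · have := middle (s := s) (by omega) (by omega) hx₁ hx hrs.2
          rw [← this.1, this.2]
        · have := middle (s := s) (by omega) (by omega) hrs.1 hx hx₂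
          rw [← this.2, this.1]
  have hb := block_truncate_apply ho.sum_size ho.zero ho.size_spec c
  have hdiag : ∀ s : Fin m, block _ ho.sum_size (truncate c n) s s =
      truncate (fun x y => c (o s + x) (o s + y)) (o (s + 1) - o s) := by
    intro s
    ext i j
    exact hb s s i j
  have hG : ∀ s : Fin m, IsGCyclops (block _ ho.sum_size (truncate c n) s s) := by
    intro s
    have hs := ho.lt_succ s s.2
    have hsn : o (s + 1) ≤ n := hom s.2
    rw [hdiag]
    refine (h.shift (o s)).isGCyclops_truncate (by omega) fun x y hx hy => ?_
    rcases le_total x y with hxy | hxy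
    · exact hpos _ _ (by omega) (by omega)
    · exact inside s.2 (by omega) (by omega) (by omega)
  refine ⟨m, fun s => o (s + 1) - o s, ho.sum_size, fun s t => c (r s) (r t), q, ?_⟩
  refine
    { one_le_q := hq₁
      q_lt := hqm
      lower := fun s t hts => ?_
      first := fun s hs => ⟨hG s, fun i j hj => ?_⟩
      last := fun s hs => ⟨hG s, fun i j hi => ?_⟩
      upper := fun s t hst => ?_
      middle := fun s hs₀ hsm => ?_
      left_anti := fun s t hst ht => ?_
      left_pos := fun s _ => h.pos _
      right_mono := fun s t hst hs => ?_
      right_pos := fun s _ => h.pos _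
      left_eq := fun s t hst ht => hdesc _ _ (hrle hst.le) (hr₁ ht)
      right_eq := fun s t hst hs => hasc _ _ (hr₂ hs s.2).1 (hrle hst.le)
        (hr₂ (hs.trans (Fin.le_def.1 hst.le)) t.2).2
      cross := fun u v hu hv s t hs ht => ?_ }
  · ext i j
    rw [hb]
    exact below (s := t) (t := s) hts s.2 (by omega) (by omega)
  · have h₁ : o s + j = r s := by
      simp only [r, hs, hq₁, Nat.lt_of_succ_le, if_true] at hj ⊢
      omega
    rw [hb, h₁]
    exact hdesc _ _ (by omega) (hr₁ (by omega))
  · have h₁ : o s + i = r s := by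
      have : ¬ (s : ℕ) < q := by omega
      simp only [r, this, if_false]
      omega
    rw [hb, h₁]
    have := hr₂ (s := s) (by omega) s.2
    have h₂ : o (s + 1) ≤ n := hom s.2
    exact hasc _ _ this.1 (by omega) (by omega)
  · ext i j
    rw [hb]
    exact flat hst t.2 (by omega) (by omega) (by omega) (by omega)
  · have hs := ho.lt_succ s s.2
    have hrs := hr s.2
    have hsn : o (s + 1) ≤ n := hom s.2
    -- Among three indices, the middle one would force a strict change of the diagonal, which is
    -- constant on a middle block.
    have hle : o (s + 1) ≤ o s + 2 := by
      by_contra hlt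
      have m₁ := middle (x := o s) (y := o s + 1) hs₀ hsm (by omega) (by omega) (by omega)
      have m₂ := middle (x := o s + 1) (y := o s + 2) hs₀ hsm (by omega) (by omega) (by omega)
      have p₁ := inside (x := o s) (y := o s + 1) s.2 (by omega) (by omega) (by omega)
      have p₂ := inside (x := o s + 1) (y := o s + 2) s.2 (by omega) (by omega) (by omega)
      rcases h.left_or_right_of_pos (i := o s) (j := o s + 1) (l := o s + 2) (by omega) (by omega)
        (hpos _ _ (by omega) (by omega)) (hpos _ _ (by omega) (by omega)) p₁ p₂ with hc | hc
      · have := h.diag_lt_of_right (by omega) hc.1 hc.2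
        rw [← m₁.1, m₁.2] at this
        exact lt_irrefl _ this
      · have := h.diag_lt_of_left (by omega) hc.1 hc.2
        rw [← m₂.1, m₂.2] at this
        exact lt_irrefl _ this
    have hrd : c (r s) (r s) = c (o s) (o s) := by
      have := middle hs₀ hsm le_rfl hrs.1 hrs.2
      rw [← this.2, this.1]
    rcases (show o (s + 1) = o s + 1 ∨ o (s + 1) = o s + 2 by omega) with h₁ | h₂
    · refine Or.inl ⟨by omega, h.pos _, ?_⟩
      ext i j
      have hi : (i : ℕ) = 0 := by omega
      have hj : (j : ℕ) = 0 := by omega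
      obtain rfl : i = 0 := Subsingleton.elim _ _
      obtain rfl : j = 0 := Subsingleton.elim _ _
      simp [hb, hrd]
    · have m₁ := middle (x := o s) (y := o s + 1) hs₀ hsm (by omega) (by omega) (by omega)
      have p₁ := inside (x := o s) (y := o s + 1) s.2 (by omega) (by omega) (by omega)
      refine Or.inr ⟨by omega, c (o s + 1) (o s), p₁, ?_, ?_⟩
      · rw [hrd]
        refine (h.le_right _ _).lt_of_ne fun he => ?_
        have := h.diag_lt_of_left (show o s < o s + 1 by omega) m₁.1 he
        rw [← m₁.1, m₁.2] at this
        exact lt_irrefl _ this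
      · ext i j
        fin_cases i <;> fin_cases j <;> simp [hb, hrd, m₁.1]
        rw [← m₁.2, m₁.1]
  · rw [← hdesc _ _ (hrle hst) (hr₁ ht)]
    exact h.le_left _ _
  · rw [← hasc _ _ (hr₂ hs s.2).1 (hrle hst) (hr₂ (hs.trans (Fin.le_def.1 hst)) t.2).2]
    exact h.le_right _ _
  · have e : ∀ {s t : Fin m}, s.val < q → q ≤ t.val → c (r s) (r t) = c k₀ (k₀ + 1) := fun hs ht =>
      cross (hr₁ hs) (hr₂ ht (Fin.is_lt _)).1 (hr₂ ht (Fin.is_lt _)).2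
    have e' := e (s := u) (t := v) (by omega) hv.ge
    simp only [e hs ht, e']
    refine ⟨hpos _ _ (by omega) hk₀n, trivial, ?_⟩
    rw [← e']
    exact le_min (h.le_left _ _) (h.le_right _ _)

/-! ### Decomposition into irreducible blocks -/

/-- The block diagonal extension of a finite matrix by an infinite identity matrix. -/
noncomputable def extend {n : ℕ} (C : Matrix (Fin n) (Fin n) ℝ) (x y : ℕ) : ℝ :=
  if h : x < n ∧ y < n then C ⟨x, h.1⟩ ⟨y, h.2⟩ else if x = y then 1 else 0

section extend

variable {n : ℕ} {C : Matrix (Fin n) (Fin n) ℝ}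

theorem extend_of_lt {x y : ℕ} (hx : x < n) (hy : y < n) :
    extend C x y = C ⟨x, hx⟩ ⟨y, hy⟩ := by
  simp [extend, hx, hy]

theorem extend_of_ne {x y : ℕ} (h : ¬ (x < n ∧ y < n)) (hxy : x ≠ y) : extend C x y = 0 := by
  simp [extend, h, hxy]

theorem extend_self_of_le {x : ℕ} (h : n ≤ x) : extend C x x = 1 := by
  simp [extend, h.not_gt]

theorem truncate_extend : truncate (extend C) n = C := by
  ext i j
  exact extend_of_lt i.2 j.2

/-- An index beyond the matrix is joined to every other index by zeros only, so the largest index of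
such a triple is an apex and the Markov identities read `0 = 0`. -/
theorem IsMarkovUltrametric.isRegular_extend (h : IsMarkovUltrametric C) (hpos : ∀ i, 0 < C i i)
    (hC : IsUnit C) : IsRegular (extend C) := by
  have hp : ∀ x, 0 < extend C x x := by
    intro x
    rcases lt_or_ge x n with hx | hx
    · rw [extend_of_lt hx hx]; exact hpos _
    · rw [extend_self_of_le hx]; exact one_pos
  have hnn : ∀ x y, 0 ≤ extend C x y := by
    intro x y
    rw [extend]
    split_ifs
    · exact h.nonneg _ _
    · exact zero_le_one
    · exact le_rfl
  have hle : ∀ x y, extend C x y ≤ extend C x x ∧ extend C x y ≤ extend C y y := by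
    intro x y
    by_cases hxy : x < n ∧ y < n
    · rw [extend_of_lt hxy.1 hxy.2, extend_of_lt hxy.1 hxy.1, extend_of_lt hxy.2 hxy.2]
      exact ⟨h.le_left _ _, h.le_right _ _⟩
    · by_cases he : x = y
      · subst he; exact ⟨le_rfl, le_rfl⟩
      · rw [extend_of_ne hxy he]; exact ⟨(hp x).le, (hp y).le⟩
  refine ⟨⟨hnn, fun x y => (hle x y).1, fun x y => (hle x y).2, ?_, ?_, ?_⟩, hp, ?_⟩
  · intro i j l hij hjl
    by_cases hl : l < n
    · have hj := hjl.trans hl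
      have hi := hij.trans hj
      simp only [IsApex, extend_of_lt, hl, hj, hi]
      exact h.apex ⟨i, hi⟩ ⟨j, hj⟩ ⟨l, hl⟩ hij hjl
    · refine Or.inr (Or.inr ?_)
      have e₁ : extend C l i = 0 := extend_of_ne (by omega) (by omega)
      have e₂ : extend C l j = 0 := extend_of_ne (by omega) (by omega)
      have e₃ : extend C i l = 0 := extend_of_ne (by omega) (by omega)
      have e₄ : extend C j l = 0 := extend_of_ne (by omega) (by omega)
      refine ⟨by rw [e₁, e₂], by rw [e₃, e₄], ?_, ?_⟩
      · rw [e₁, e₃, min_self]; exact le_min (hnn _ _) (hnn _ _)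
      · rw [e₁, e₃, max_self]; exact (hnn _ _).trans (le_max_left _ _)
  · intro i j l hij hjl
    by_cases hl : l < n
    · have hj := hjl.trans hl
      have hi := hij.trans hj
      simp only [extend_of_lt, hl, hj, hi]
      exact h.upper ⟨i, hi⟩ ⟨j, hj⟩ ⟨l, hl⟩ hij hjl
    · rw [extend_of_ne (x := i) (y := l) (by omega) (by omega),
        extend_of_ne (x := j) (y := l) (by omega) (by omega), zero_mul, mul_zero]
  · intro i j l hij hjl
    by_cases hl : l < n
    · have hj := hjl.trans hl
      have hi := hij.trans hj
      simp only [extend_of_lt, hl, hj, hi]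
      exact h.lower ⟨i, hi⟩ ⟨j, hj⟩ ⟨l, hl⟩ hij hjl
    · rw [extend_of_ne (x := l) (y := i) (by omega) (by omega),
        extend_of_ne (x := l) (y := j) (by omega) (by omega), zero_mul, zero_mul]
  · intro i
    by_cases hi : i + 1 < n
    · rw [extend_of_lt (by omega) hi, extend_of_lt hi (by omega), extend_of_lt hi hi,
        extend_of_lt (by omega) (by omega)]
      exact (isUnit_iff_adjacent h hpos).1 hC ⟨i, by omega⟩ ⟨i + 1, hi⟩ rfl
    · rw [extend_of_ne (by omega) (by omega), zero_mul]
      exact mul_pos (hp _) (hp _)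

end extend

theorem IsRegular.truncate_irreducible {c : ℕ → ℕ → ℝ} (h : IsRegular c) {k : ℕ} (hk : 1 ≤ k)
    (hirr : ∀ x, x + 1 < k → c x (x + 1) ≠ 0 ∨ c (x + 1) x ≠ 0) :
    IsPositiveCyclops (truncate c k) ∨ IsNestedUpper (truncate c k) ∨
      IsNestedUpper (truncate c k).transpose := by
  have key : ∀ {c : ℕ → ℕ → ℝ}, IsRegular c → (∀ x, x + 1 < k → 0 < c x (x + 1)) →
      (∀ x y, x < k → y < k → 0 < c x y) ∨ IsNestedUpper (truncate c k) := by
    clear! c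
    intro c h hu
    have hup : ∀ x y, x ≤ y → y < k → 0 < c x y := fun x y hxy hy =>
      h.pos_upper hxy fun j _ hj => hu j (by omega)
    by_cases hz : ∃ x, x + 1 < k ∧ c (x + 1) x = 0
    · exact Or.inr (h.isNestedUpper_truncate hup hz)
    · refine Or.inl fun x y hx hy => ?_
      rcases le_total x y with hxy | hxy
      · exact hup x y hxy hy
      · exact h.pos_lower hxy fun j _ hj =>
          (h.nonneg _ _).lt_of_ne' fun h0 => hz ⟨j, by omega, h0⟩
  rcases h.pos_upper_or_lower hirr with hu | hl
  · exact (key h hu).imp (h.isPositiveCyclops_truncate hk) Or.inl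
  · exact (key h.swap hl).imp (fun hp => h.isPositiveCyclops_truncate hk fun x y hx hy => hp y x hy hx)
      Or.inr

/-- Cuts are placed where both entries next to the diagonal vanish. By the Markov property such
zeros spread to all entries across the cut, and every segment between cuts is irreducible. -/
theorem IsMarkovUltrametric.isDirectSumOf {n : ℕ} {C : Matrix (Fin n) (Fin n) ℝ}
    (hM : IsMarkovUltrametric C) (hpos : ∀ i, 0 < C i i) (hC : IsUnit C) :
    IsDirectSumOf (fun _ M => IsPositiveCyclops M ∨ IsNestedUpper M ∨ IsNestedUpper M.transpose)
      C := by
  have h := hM.isRegular_extend hpos hC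
  rw [← truncate_extend (C := C)]
  set c := extend C
  obtain ⟨m, o, ho, hcut, hncut⟩ :=
    exists_isPartition (fun x => c (x - 1) x = 0 ∧ c x (x - 1) = 0) n
  have hoff : ∀ {s t : ℕ} {x y : ℕ}, s < t → t < m → x < o (s + 1) → o t ≤ y →
      c x y = 0 ∧ c y x = 0 := by
    intro s t x y hst ht hx hy
    have h₁ : o (s + 1) ≤ o t := ho.le hst ht.le
    have h₂ := hcut t (by omega) ht
    have h₃ : o t - 1 + 1 = o t := Nat.sub_add_cancel (by omega)
    exact ⟨h.upper_eq_zero (k := o t - 1) (by omega) (by omega) (by rw [h₃]; exact h₂.1),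
      h.lower_eq_zero (k := o t - 1) (by omega) (by omega) (by rw [h₃]; exact h₂.2)⟩
  refine ⟨m, fun s => o (s + 1) - o s, ho.sum_size,
    fun s => truncate (fun x y => c (o s + x) (o s + y)) _, fun s => ?_, ?_⟩
  · have := ho.lt_succ s s.2
    refine (h.shift (o s)).truncate_irreducible (by dsimp only; omega) fun x hx => ?_
    dsimp only at hx
    have := hncut s s.2 (o s + x + 1) (by omega) (by omega)
    rw [← not_and_or]
    exact this
  · ext ⟨s, i⟩ ⟨t, j⟩
    rw [Matrix.submatrix_apply, truncate_apply, blockIndex_val ho.sum_size ho.zero ho.size_spec,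
      blockIndex_val ho.sum_size ho.zero ho.size_spec]
    rcases lt_trichotomy s t with hst | rfl | hst
    · rw [Matrix.blockDiagonal'_apply_ne _ _ _ hst.ne]
      exact (hoff (s := s) (t := t) hst t.2 (by simp only; omega) (by simp)).1
    · rw [Matrix.blockDiagonal'_apply_eq]
      rfl
    · rw [Matrix.blockDiagonal'_apply_ne _ _ _ hst.ne']
      exact (hoff (s := t) (t := s) hst s.2 (by simp only; omega) (by simp)).2

/-! ### The block forms are Markov ultrametric matrices -/

theorem IsCyclops.spec {n m : ℕ} {C : Matrix (Fin n) (Fin n) ℝ} {a : Fin n → ℝ} {b₁ b₂ : ℝ}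
    (h : IsCyclops C m a b₁ b₂) :
    (∀ x y : Fin n, x ≤ y → y.val < m → C x y = a y ∧ C y x = a y) ∧
    (∀ x y : Fin n, x < y → y.val < m → a y < a x) ∧
    (∀ x y : Fin n, x ≤ y → m ≤ x.val → C x y = a x ∧ C y x = a x) ∧
    (∀ x y : Fin n, x < y → m ≤ x.val → a x < a y) ∧
    (∀ x y : Fin n, x.val < m → m ≤ y.val → C x y = b₁ ∧ C y x = b₂) := by
  obtain ⟨p, rfl, C₁₁, C₂₂, ⟨hs₁, h₁⟩, ⟨hs₂, h₂⟩, hC⟩ := h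
  have e₁₁ : ∀ i j, C (Fin.castAdd p i) (Fin.castAdd p j) = C₁₁ i j := fun i j => by
    simpa using congrFun (congrFun hC (Sum.inl i)) (Sum.inl j)
  have e₁₂ : ∀ i j, C (Fin.castAdd p i) (Fin.natAdd m j) = b₁ := fun i j => by
    simpa using congrFun (congrFun hC (Sum.inl i)) (Sum.inr j)
  have e₂₁ : ∀ i j, C (Fin.natAdd m i) (Fin.castAdd p j) = b₂ := fun i j => by
    simpa using congrFun (congrFun hC (Sum.inr i)) (Sum.inl j)
  have e₂₂ : ∀ i j, C (Fin.natAdd m i) (Fin.natAdd m j) = C₂₂ i j := fun i j => by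
    simpa using congrFun (congrFun hC (Sum.inr i)) (Sum.inr j)
  have l : ∀ x : Fin (m + p), x.val < m → ∃ i : Fin m, x = Fin.castAdd p i := fun x hx =>
    ⟨⟨x, hx⟩, rfl⟩
  have r : ∀ x : Fin (m + p), m ≤ x.val → ∃ i : Fin p, x = Fin.natAdd m i := fun x hx =>
    ⟨⟨x - m, by omega⟩, by ext; simp; omega⟩
  refine ⟨fun x y hxy hy => ?_, fun x y hxy hy => ?_, fun x y hxy hx => ?_, fun x y hxy hx => ?_,
    fun x y hx hy => ?_⟩
  · obtain ⟨i, rfl⟩ := l x (lt_of_le_of_lt hxy hy)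
    obtain ⟨j, rfl⟩ := l y hy
    have hij : i ≤ j := hxy
    have u := h₁ i.rev j.rev
    have v := h₁ j.rev i.rev
    simp only [Matrix.submatrix_apply, Fin.rev_rev, Fin.rev_le_rev, hij, if_true] at u v
    rw [e₁₁, e₁₁, u, v]
    refine ⟨?_, rfl⟩
    split_ifs with hji
    · rw [le_antisymm hij hji]; rfl
    · rfl
  · obtain ⟨i, rfl⟩ := l x (lt_trans hxy hy)
    obtain ⟨j, rfl⟩ := l y hy
    simpa using hs₁ (Fin.rev_lt_rev.2 (show i < j from hxy))
  · obtain ⟨i, rfl⟩ := r x hx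
    obtain ⟨j, rfl⟩ := r y (hx.trans hxy)
    have hij : i ≤ j := by simpa using hxy
    rw [e₂₂, e₂₂, h₂, h₂, if_pos hij]
    refine ⟨rfl, ?_⟩
    split_ifs with hji
    · rw [le_antisymm hij hji]; rfl
    · rfl
  · obtain ⟨i, rfl⟩ := r x hx
    obtain ⟨j, rfl⟩ := r y (hx.trans hxy.le)
    exact hs₂ (show i < j by simpa using hxy)
  · obtain ⟨i, rfl⟩ := l x hx
    obtain ⟨j, rfl⟩ := r y hy
    exact ⟨e₁₂ i j, e₂₁ j i⟩

theorem IsPositiveCyclops.spec {n : ℕ} {C : Matrix (Fin n) (Fin n) ℝ} (h : IsPositiveCyclops C) :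
    ∃ (m : ℕ) (a : Fin n → ℝ) (b₁ b₂ : ℝ), 1 ≤ m ∧ m ≤ n ∧ 0 < b₁ ∧ 0 < b₂ ∧ (∀ i, b₁ ≤ a i) ∧
      (∀ i, b₂ ≤ a i) ∧
    (∀ x y : Fin n, x ≤ y → y.val < m → C x y = a y ∧ C y x = a y) ∧
    (∀ x y : Fin n, x < y → y.val < m → a y < a x) ∧
    (∀ x y : Fin n, x ≤ y → m ≤ x.val → C x y = a x ∧ C y x = a x) ∧
    (∀ x y : Fin n, x < y → m ≤ x.val → a x < a y) ∧
    (∀ x y : Fin n, x.val < m → m ≤ y.val → C x y = b₁ ∧ C y x = b₂) := by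
  obtain ⟨m, a, b₁, b₂, hm, hmn, hC, hle, hb⟩ := h
  obtain ⟨hb₁, hb₂⟩ := lt_min_iff.1 hb
  have hs := hC.spec
  -- The bound is assumed only for the parameters next to the eye, which are the least on their
  -- sides.
  have hmax : ∀ i, max b₁ b₂ ≤ a i := by
    intro i
    rcases lt_or_ge i.val m with hi | hi
    · have hm' := hle ⟨m - 1, by omega⟩ (Or.inl (by simp; omega))
      rcases (show i ≤ ⟨m - 1, by omega⟩ by simp [Fin.le_def]; omega).eq_or_lt with hi' | hi'
      · rwa [hi']
      · exact hm'.trans (hs.2.1 _ _ hi' (by simp; omega)).le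
    · have hm' := hle ⟨m, by omega⟩ (Or.inr rfl)
      rcases (show (⟨m, by omega⟩ : Fin n) ≤ i from hi).eq_or_lt with hi' | hi'
      · rwa [← hi']
      · exact hm'.trans (hs.2.2.2.1 _ _ hi' le_rfl).le
  exact ⟨m, a, b₁, b₂, hm, hmn, hb₁, hb₂, fun i => (le_max_left _ _).trans (hmax i),
    fun i => (le_max_right _ _).trans (hmax i), hs⟩

theorem IsPositiveCyclops.isMarkovUltrametric {n : ℕ} {C : Matrix (Fin n) (Fin n) ℝ}
    (h : IsPositiveCyclops C) : IsMarkovUltrametric C := by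
  obtain ⟨m, a, b₁, b₂, -, -, hb₁, hb₂, h₁, h₂, hl, hls, hr, hrs, hc⟩ := h.spec
  have hd : ∀ x, C x x = a x := fun x => by
    rcases lt_or_ge x.val m with hx | hx
    · exact (hl x x le_rfl hx).1
    · exact (hr x x le_rfl hx).1
  have ha : ∀ x, 0 < a x := fun x => hb₁.trans_le (h₁ x)
  have hle : ∀ x y, x < y → (0 < C x y ∧ C x y ≤ a x ∧ C x y ≤ a y) ∧
      (0 < C y x ∧ C y x ≤ a x ∧ C y x ≤ a y) := by
    intro x y hxy
    rcases lt_or_ge y.val m with hy | hy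
    · have e := hl x y hxy.le hy
      rw [e.1, e.2]
      exact ⟨⟨ha _, (hls x y hxy hy).le, le_rfl⟩, ⟨ha _, (hls x y hxy hy).le, le_rfl⟩⟩
    · rcases lt_or_ge x.val m with hx | hx
      · have e := hc x y hx hy
        rw [e.1, e.2]
        exact ⟨⟨hb₁, h₁ _, h₁ _⟩, ⟨hb₂, h₂ _, h₂ _⟩⟩
      · have e := hr x y hxy.le hx
        rw [e.1, e.2]
        exact ⟨⟨ha _, le_rfl, (hrs x y hxy hx).le⟩, ⟨ha _, le_rfl, (hrs x y hxy hx).le⟩⟩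
  have hall : ∀ x y, 0 < C x y ∧ C x y ≤ C x x ∧ C x y ≤ C y y := by
    intro x y
    simp only [hd]
    rcases lt_trichotomy x y with hxy | rfl | hxy
    · exact (hle x y hxy).1
    · rw [hd]; exact ⟨ha _, le_rfl, le_rfl⟩
    · have := (hle y x hxy).2
      exact ⟨this.1, this.2.2, this.2.1⟩
  -- The side of the eye on which `j` lies decides the apex: `l` if `j` is in the descending part,
  -- `i` if it is in the ascending part.
  have cases3 : ∀ i j l, i < j → j < l →
      (C l i = C l j ∧ C i l = C j l ∧ C i j = C j j ∧ C j i = C j j) ∨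
      (C i j = C i l ∧ C j i = C l i ∧ C j l = C j j ∧ C l j = C j j) := by
    intro i j l hij hjl
    rcases lt_or_ge j.val m with hj | hj
    · have e := hl i j hij.le hj
      rw [hd, e.1, e.2]
      refine Or.inl ⟨?_, ?_, rfl, rfl⟩
      · rcases lt_or_ge l.val m with hl' | hl'
        · rw [(hl i l (hij.trans hjl).le hl').2, (hl j l hjl.le hl').2]
        · rw [(hc i l (lt_trans hij hj) hl').2, (hc j l hj hl').2]
      · rcases lt_or_ge l.val m with hl' | hl'
        · rw [(hl i l (hij.trans hjl).le hl').1, (hl j l hjl.le hl').1]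
        · rw [(hc i l (lt_trans hij hj) hl').1, (hc j l hj hl').1]
    · have e := hr j l hjl.le hj
      rw [hd, e.1, e.2]
      refine Or.inr ⟨?_, ?_, rfl, rfl⟩
      · rcases lt_or_ge i.val m with hi | hi
        · rw [(hc i j hi hj).1, (hc i l hi (hj.trans hjl.le)).1]
        · rw [(hr i j hij.le hi).1, (hr i l (hij.trans hjl).le hi).1]
      · rcases lt_or_ge i.val m with hi | hi
        · rw [(hc i j hi hj).2, (hc i l hi (hj.trans hjl.le)).2]
        · rw [(hr i j hij.le hi).2, (hr i l (hij.trans hjl).le hi).2]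
  refine ⟨fun i j => (hall i j).1.le, fun i j => (hall i j).2.1, fun i j => (hall i j).2.2,
    fun i j l hij hjl => ?_, fun i j l hij hjl => ?_, fun i j l hij hjl => ?_⟩
  · rcases cases3 i j l hij hjl with ⟨e₁, e₂, e₃, e₄⟩ | ⟨e₁, e₂, e₃, e₄⟩
    · refine Or.inr (Or.inr ⟨e₁, e₂, ?_, ?_⟩)
      · rw [e₃, e₄, min_self, e₂]
        exact (min_le_left _ _).trans (hall _ _).2.1
      · rw [e₃, e₄, max_self, e₂, e₁]
        exact max_le (hall _ _).2.1 (hall _ _).2.2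
    · refine Or.inl ⟨e₁, e₂, ?_, ?_⟩
      · rw [e₃, e₄, min_self]
        exact (min_le_left _ _).trans (hall _ _).2.1
      · rw [e₃, e₄, max_self]
        exact max_le (hall _ _).2.1 (hall _ _).2.2
  · rcases cases3 i j l hij hjl with ⟨e₁, e₂, e₃, e₄⟩ | ⟨e₁, e₂, e₃, e₄⟩
    · rw [e₂, e₃, mul_comm]
    · rw [← e₁, e₃]
  · rcases cases3 i j l hij hjl with ⟨e₁, e₂, e₃, e₄⟩ | ⟨e₁, e₂, e₃, e₄⟩
    · rw [e₁, e₄]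
    · rw [← e₂, e₄, mul_comm]

/-! ### Nested block matrices -/

/-- A diagonal block on the descending side of a nested block matrix. -/
structure IsDescendingBlock {k : ℕ} (D : Matrix (Fin k) (Fin k) ℝ) (f : ℝ) : Prop where
  nonneg : ∀ i j, 0 ≤ D i j
  le_diag : ∀ i, f ≤ D i i
  right : ∀ i j, i ≤ j → D i j = D j j ∧ D j j ≤ D i i ∧ D j i ≤ D j j
  lower : ∀ i j l, i < j → j < l → D l i = D l j ∧ D j i = D j j

/-- A diagonal block on the ascending side of a nested block matrix. -/
structure IsAscendingBlock {k : ℕ} (D : Matrix (Fin k) (Fin k) ℝ) (f : ℝ) : Prop where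
  nonneg : ∀ i j, 0 ≤ D i j
  le_diag : ∀ i, f ≤ D i i
  left : ∀ i j, i ≤ j → D i j = D i i ∧ D i i ≤ D j j ∧ D j i ≤ D i i
  lower : ∀ i j l, i < j → j < l → D l i = D j i ∧ D l j = D j j

theorem IsPositiveCyclops.isDescendingBlock {k : ℕ} {D : Matrix (Fin k) (Fin k) ℝ} {f : ℝ}
    (h : IsPositiveCyclops D) (hf : ∀ i j : Fin k, j.val + 1 = k → D i j = f) :
    IsDescendingBlock D f := by
  have hnn := h.isMarkovUltrametric.nonneg
  obtain ⟨m, a, b₁, b₂, hm, hmk, hb₁, hb₂, h₁, h₂, hl, hls, hr, hrs, hc⟩ := h.spec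
  let z : Fin k := ⟨k - 1, by omega⟩
  have hz : z.val + 1 = k := by simp only [z]; omega
  -- A constant last column contradicts strict ascent, so at most the last index lies beyond the
  -- eye.
  have hlast : ∀ j : Fin k, m ≤ j.val → j = z := by
    intro j hj
    by_contra hne
    have hjz : j < z := by rw [Fin.lt_def]; omega
    have e₁ := (hr j z hjz.le hj).1
    have e₂ := (hr z z le_rfl (hj.trans hjz.le)).1
    rw [hf _ _ hz] at e₁ e₂
    exact (hrs j z hjz hj).ne (e₁.symm.trans e₂)
  have right : ∀ i j, i ≤ j → D i j = D j j ∧ D j j ≤ D i i ∧ D j i ≤ D j j := by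
    intro i j hij
    rcases hij.eq_or_lt with rfl | hij
    · exact ⟨rfl, le_rfl, le_rfl⟩
    rcases lt_or_ge j.val m with hj | hj
    · have e := hl i j hij.le hj
      rw [e.1, e.2, (hl j j le_rfl hj).1, (hl i i le_rfl (lt_trans hij hj)).1]
      exact ⟨rfl, (hls i j hij hj).le, le_rfl⟩
    · obtain rfl := hlast j hj
      have hi : i.val < m := by
        by_contra hi
        exact hij.ne (hlast i (not_lt.1 hi))
      have e := hc i z hi hj
      rw [hf i z hz, hf z z hz]
      refine ⟨rfl, ?_, ?_⟩
      · rw [← hf i z hz, e.1, (hl i i le_rfl hi).1]; exact h₁ i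
      · rw [← hf z z hz, e.2, (hr z z le_rfl hj).1]; exact h₂ z
  refine ⟨hnn, fun i => ?_, right, fun i j l hij hjl => ?_⟩
  · rw [← hf z z hz]
    exact (right i z (by rw [Fin.le_def]; omega)).2.1
  · have hj : j.val < m := by
      by_contra hj
      have := hlast j (not_lt.1 hj)
      subst this
      rw [Fin.lt_def] at hjl
      omega
    refine ⟨?_, by rw [(hl i j hij.le hj).2, (hl j j le_rfl hj).2]⟩
    rcases lt_or_ge l.val m with hl' | hl'
    · rw [(hl i l (hij.trans hjl).le hl').2, (hl j l hjl.le hl').2]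
    · rw [(hc i l (lt_trans hij hj) hl').2, (hc j l hj hl').2]

theorem IsPositiveCyclops.isAscendingBlock {k : ℕ} {D : Matrix (Fin k) (Fin k) ℝ} {f : ℝ}
    (h : IsPositiveCyclops D) (hf : ∀ i j : Fin k, i.val = 0 → D i j = f) :
    IsAscendingBlock D f := by
  have hnn := h.isMarkovUltrametric.nonneg
  obtain ⟨m, a, b₁, b₂, hm, hmk, hb₁, hb₂, h₁, h₂, hl, hls, hr, hrs, hc⟩ := h.spec
  let z : Fin k := ⟨0, by omega⟩
  have hz : z.val = 0 := rfl
  have hzm : z.val < m := hm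
  have hzle : ∀ i : Fin k, z ≤ i := fun i => Nat.zero_le _
  -- Likewise a constant first row leaves only the first index in the descending part.
  have hfirst : ∀ j : Fin k, j.val < m → j = z := by
    intro j hj
    by_contra hne
    have hjz : z < j := (hzle j).lt_of_ne' hne
    have e₁ := (hl z j hjz.le hj).1
    have e₂ := (hl z z le_rfl hzm).1
    rw [hf _ _ hz] at e₁ e₂
    exact (hls z j hjz hj).ne (e₁.symm.trans e₂)
  have left : ∀ i j, i ≤ j → D i j = D i i ∧ D i i ≤ D j j ∧ D j i ≤ D i i := by
    intro i j hij
    rcases hij.eq_or_lt with rfl | hij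
    · exact ⟨rfl, le_rfl, le_rfl⟩
    rcases lt_or_ge i.val m with hi | hi
    · obtain rfl := hfirst i hi
      have hj : m ≤ j.val := by
        by_contra hj
        exact hij.ne' (hfirst j (not_le.1 hj))
      have e := hc z j hi hj
      rw [hf z j hz, hf z z hz]
      refine ⟨rfl, ?_, ?_⟩
      · rw [← hf z j hz, e.1, (hr j j le_rfl hj).1]; exact h₁ j
      · rw [← hf z z hz, e.2, (hl z z le_rfl hi).1]; exact h₂ z
    · have e := hr i j hij.le hi
      rw [e.1, e.2, (hr i i le_rfl hi).1, (hr j j le_rfl (hi.trans hij.le)).1]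
      exact ⟨rfl, (hrs i j hij hi).le, le_rfl⟩
  refine ⟨hnn, fun i => ?_, left, fun i j l hij hjl => ?_⟩
  · rw [← hf z z hz]
    exact (left z i (hzle i)).2.1
  · have hj : m ≤ j.val := by
      by_contra hj
      have := hfirst j (not_le.1 hj)
      subst this
      exact (hzle i).not_gt hij
    refine ⟨?_, by rw [(hr j l hjl.le hj).2, (hr j j le_rfl hj).2]⟩
    rcases lt_or_ge i.val m with hi | hi
    · rw [(hc i j hi hj).2, (hc i l hi (hj.trans hjl.le)).2]
    · rw [(hr i j hij.le hi).2, (hr i l (hij.trans hjl).le hi).2]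

/-- The entries of a nested block matrix, the first `z` rows and columns being those of the
descending blocks. -/
structure IsNested {n : ℕ} (C : Matrix (Fin n) (Fin n) ℝ) (z : ℕ) (w : ℝ) : Prop where
  nonneg : ∀ x y, 0 ≤ C x y
  left : ∀ x y, x ≤ y → y.val < z → C x y = C y y ∧ C y y ≤ C x x ∧ C y x ≤ C y y
  right : ∀ x y, x ≤ y → z ≤ x.val → C x y = C x x ∧ C x x ≤ C y y ∧ C y x ≤ C x x
  cross : ∀ x y, x.val < z → z ≤ y.val → C x y = w ∧ C y x = 0 ∧ w ≤ C x x ∧ w ≤ C y y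
  left_lower : ∀ i j l, i < j → j < l → l.val < z →
    (C l j = 0 ∧ C l i = 0) ∨ (C j i = 0 ∧ C l i = 0 ∧ C j j = C l l) ∨
      (C l i = C l j ∧ C j i = C j j)
  right_lower : ∀ i j l, i < j → j < l → z ≤ i.val →
    (C j i = 0 ∧ C l i = 0) ∨ (C l j = 0 ∧ C l i = 0 ∧ C j j = C i i) ∨
      (C l i = C j i ∧ C l j = C j j)

/-- For `j` on the descending side `l` is the apex, except when `i` alone is cut off by zeros below
the diagonal, where `i` is. The ascending side is the mirror image. -/
theorem IsNested.isMarkovUltrametric {n : ℕ} {C : Matrix (Fin n) (Fin n) ℝ} {z : ℕ} {w : ℝ}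
    (h : IsNested C z w) : IsMarkovUltrametric C := by
  have hle : ∀ x y, x ≤ y → (C x y ≤ C x x ∧ C x y ≤ C y y) ∧ (C y x ≤ C x x ∧ C y x ≤ C y y) := by
    intro x y hxy
    rcases lt_or_ge y.val z with hy | hy
    · obtain ⟨e, h₁, h₂⟩ := h.left x y hxy hy
      rw [e]
      exact ⟨⟨h₁, le_rfl⟩, ⟨h₂.trans h₁, h₂⟩⟩
    · rcases lt_or_ge x.val z with hx | hx
      · obtain ⟨e₁, e₂, h₁, h₂⟩ := h.cross x y hx hy
        rw [e₁, e₂]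
        exact ⟨⟨h₁, h₂⟩, h.nonneg _ _, h.nonneg _ _⟩
      · obtain ⟨e, h₁, h₂⟩ := h.right x y hxy hx
        rw [e]
        exact ⟨⟨le_rfl, h₁⟩, ⟨h₂, h₂.trans h₁⟩⟩
  have hall : ∀ x y, C x y ≤ C x x ∧ C x y ≤ C y y := by
    intro x y
    rcases le_total x y with hxy | hxy
    · exact (hle x y hxy).1
    · exact (hle y x hxy).2.symm
  have key : ∀ i j l, i < j → j < l →
      (IsApex C i j l ∨ IsApex C j i l ∨ IsApex C l i j) ∧ C i l * C j j = C i j * C j l ∧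
        C l i * C j j = C l j * C j i := by
    intro i j l hij hjl
    have hil := hij.trans hjl
    have hn := h.nonneg
    rcases lt_or_ge j.val z with hj | hj
    · obtain ⟨e, h₁, h₂⟩ := h.left i j hij.le hj
      rcases lt_or_ge l.val z with hl | hl
      · obtain ⟨e', h₁', h₂'⟩ := h.left j l hjl.le hl
        obtain ⟨e'', h₁'', h₂''⟩ := h.left i l hil.le hl
        rcases h.left_lower i j l hij hjl hl with ⟨z₁, z₂⟩ | ⟨z₁, z₂, z₃⟩ | ⟨z₁, z₂⟩
        · refine ⟨Or.inr (Or.inr ⟨by rw [z₁, z₂], by rw [e', e''], ?_, ?_⟩), ?_, ?_⟩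
          · rw [z₂]
            exact (min_le_right _ _).trans (le_min (hn _ _) (hn _ _))
          · rw [z₂, e'', max_eq_left (hn _ _), e]
            exact h₁'.trans (le_max_left _ _)
          · rw [e'', e, e', mul_comm]
          · rw [z₁, z₂, zero_mul, zero_mul]
        · refine ⟨Or.inl ⟨by rw [e, e'', z₃], by rw [z₁, z₂], ?_, ?_⟩, ?_, ?_⟩
          · rw [z₁]
            exact (min_le_left _ _).trans (le_min (hn _ _) (hn _ _))
          · rw [z₁, e, z₃, max_eq_right (hn _ _), e']
            exact le_max_left _ _
          · rw [e'', e, e', mul_comm]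
          · rw [z₁, z₂, zero_mul, mul_zero]
        · refine ⟨Or.inr (Or.inr ⟨z₁, by rw [e', e''], ?_, ?_⟩), ?_, ?_⟩
          · rw [e'', e, z₂, min_self]
            exact (min_le_left _ _).trans h₁'
          · rw [e'', e, z₂, max_self]
            exact max_le h₁' (h₂''.trans h₁')
          · rw [e'', e, e', mul_comm]
          · rw [z₁, z₂]
      · obtain ⟨c₁, c₂, c₃, c₄⟩ := h.cross i l (lt_trans hij hj) hl
        obtain ⟨d₁, d₂, d₃, d₄⟩ := h.cross j l hj hl
        refine ⟨Or.inr (Or.inr ⟨by rw [c₂, d₂], by rw [c₁, d₁], ?_, ?_⟩), ?_, ?_⟩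
        · rw [c₂]
          exact (min_le_right _ _).trans (le_min (hn _ _) (hn _ _))
        · rw [c₂, max_eq_left (hn _ _), c₁, e]
          exact d₃.trans (le_max_left _ _)
        · rw [c₁, d₁, e, mul_comm]
        · rw [c₂, d₂, zero_mul, zero_mul]
    · obtain ⟨e, h₁, h₂⟩ := h.right j l hjl.le hj
      rcases lt_or_ge i.val z with hi | hi
      · obtain ⟨c₁, c₂, c₃, c₄⟩ := h.cross i j hi hj
        obtain ⟨d₁, d₂, d₃, d₄⟩ := h.cross i l hi (hj.trans hjl.le)
        refine ⟨Or.inl ⟨by rw [c₁, d₁], by rw [c₂, d₂], ?_, ?_⟩, ?_, ?_⟩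
        · rw [c₂]
          exact (min_le_left _ _).trans (le_min (hn _ _) (hn _ _))
        · rw [c₂, max_eq_right (hn _ _), c₁, e]
          exact c₄.trans (le_max_left _ _)
        · rw [c₁, d₁, e]
        · rw [c₂, d₂, zero_mul, mul_zero]
      · obtain ⟨e', h₁', h₂'⟩ := h.right i j hij.le hi
        obtain ⟨e'', h₁'', h₂''⟩ := h.right i l hil.le hi
        rcases h.right_lower i j l hij hjl hi with ⟨z₁, z₂⟩ | ⟨z₁, z₂, z₃⟩ | ⟨z₁, z₂⟩
        · refine ⟨Or.inl ⟨by rw [e', e''], by rw [z₁, z₂], ?_, ?_⟩, ?_, ?_⟩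
          · rw [z₁]
            exact (min_le_left _ _).trans (le_min (hn _ _) (hn _ _))
          · rw [z₁, max_eq_right (hn _ _), e', e]
            exact h₁'.trans (le_max_left _ _)
          · rw [e'', e', e]
          · rw [z₁, z₂, zero_mul, mul_zero]
        · refine ⟨Or.inr (Or.inr ⟨by rw [z₁, z₂], by rw [e'', e, z₃], ?_, ?_⟩), ?_, ?_⟩
          · rw [z₂]
            exact (min_le_right _ _).trans (le_min (hn _ _) (hn _ _))
          · rw [z₂, e'', max_eq_left (hn _ _), e']
            exact le_max_left _ _
          · rw [e'', e', e]
          · rw [z₁, z₂, zero_mul, zero_mul]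
        · refine ⟨Or.inl ⟨by rw [e', e''], z₁.symm, ?_, ?_⟩, ?_, ?_⟩
          · rw [e', e, z₂, min_self]
            exact (min_le_right _ _).trans h₁'
          · rw [e', e, z₂, max_self]
            exact max_le (h₂'.trans h₁') h₁'
          · rw [e'', e', e]
          · rw [z₁, z₂, mul_comm]
  exact ⟨h.nonneg, fun i j => (hall i j).1, fun i j => (hall i j).2,
    fun i j l hij hjl => (key i j l hij hjl).1, fun i j l hij hjl => (key i j l hij hjl).2.1,
    fun i j l hij hjl => (key i j l hij hjl).2.2⟩

/-- A diagonal block of a nested block matrix that is neither the first nor the last one. -/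
structure IsMiddleBlock {k : ℕ} (D : Matrix (Fin k) (Fin k) ℝ) (f : ℝ) : Prop where
  nonneg : ∀ i j, 0 ≤ D i j
  le : ∀ i j, D i j ≤ f
  eq : ∀ i j, i ≤ j → D i j = f
  size : k ≤ 2

theorem isMiddleBlock_of_reindex {k : ℕ} {D : Matrix (Fin k) (Fin k) ℝ} {f : ℝ}
    (h : (∃ h₁ : k = 1, 0 < f ∧ D.reindex (finCongr h₁) (finCongr h₁) = !![f]) ∨
      (∃ (h₂ : k = 2) (g : ℝ), 0 < g ∧ g < f ∧
        D.reindex (finCongr h₂) (finCongr h₂) = !![f, f; g, f])) :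
    IsMiddleBlock D f := by
  rcases h with ⟨rfl, hf, hD⟩ | ⟨rfl, g, hg, hgf, hD⟩
  · have hD : D = !![f] := by simpa using hD
    subst hD
    refine ⟨?_, ?_, ?_, by norm_num⟩ <;> intro i j <;> fin_cases i <;> fin_cases j <;> simp [hf.le]
  · have hD : D = !![f, f; g, f] := by simpa using hD
    subst hD
    refine ⟨?_, ?_, ?_, by norm_num⟩ <;> intro i j <;> fin_cases i <;> fin_cases j <;>
      simp [hg.le, hgf.le, (hg.trans hgf).le]

theorem IsMiddleBlock.isDescendingBlock {k : ℕ} {D : Matrix (Fin k) (Fin k) ℝ} {f : ℝ}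
    (h : IsMiddleBlock D f) : IsDescendingBlock D f where
  nonneg := h.nonneg
  le_diag i := (h.eq i i le_rfl).ge
  right i j hij := by
    rw [h.eq i j hij, h.eq i i le_rfl, h.eq j j le_rfl]
    exact ⟨rfl, le_rfl, h.le _ _⟩
  lower i j l hij hjl := by
    have := h.size
    omega

theorem IsMiddleBlock.isAscendingBlock {k : ℕ} {D : Matrix (Fin k) (Fin k) ℝ} {f : ℝ}
    (h : IsMiddleBlock D f) : IsAscendingBlock D f where
  nonneg := h.nonneg
  le_diag i := (h.eq i i le_rfl).ge
  left i j hij := by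
    rw [h.eq i j hij, h.eq i i le_rfl, h.eq j j le_rfl]
    exact ⟨rfl, le_rfl, h.le _ _⟩
  lower i j l hij hjl := by
    have := h.size
    omega

section blockIndex

variable {m n : ℕ} {d : Fin m → ℕ} (h : ∑ s, d s = n)

theorem blockIndex_surjective : Function.Surjective (blockIndex d h) :=
  (finCongr h).surjective.comp finSigmaFinEquiv.surjective

theorem offset_mono {o : ℕ → ℕ} (ho : ∀ s : Fin m, o (s + 1) = o s + d s) {s t : ℕ} (hst : s ≤ t)
    (ht : t ≤ m) : o s ≤ o t := by
  induction t, hst using Nat.le_induction with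
  | base => exact le_rfl
  | succ t _ ih => exact (ih (by omega)).trans ((ho ⟨t, ht⟩).symm ▸ Nat.le_add_right _ _)

theorem blockIndex_lt_of_lt {s t : Fin m} (hst : s < t) (i : Fin (d s)) (j : Fin (d t)) :
    blockIndex d h ⟨s, i⟩ < blockIndex d h ⟨t, j⟩ := by
  obtain ⟨o, h0, ho⟩ := exists_offset d
  have h₁ := offset_mono ho (Nat.succ_le_of_lt (Fin.lt_def.1 hst)) t.2.le
  have h₂ := ho s
  rw [Fin.lt_def, blockIndex_val h h0 ho, blockIndex_val h h0 ho]
  simp only [Nat.succ_eq_add_one] at *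
  omega

theorem le_of_blockIndex_le {s t : Fin m} {i : Fin (d s)} {j : Fin (d t)}
    (hij : blockIndex d h ⟨s, i⟩ ≤ blockIndex d h ⟨t, j⟩) : s ≤ t := by
  by_contra hst
  exact (blockIndex_lt_of_lt h (not_le.1 hst) j i).not_ge hij

theorem blockIndex_le_iff {s : Fin m} {i j : Fin (d s)} :
    blockIndex d h ⟨s, i⟩ ≤ blockIndex d h ⟨s, j⟩ ↔ i ≤ j := by
  obtain ⟨o, h0, ho⟩ := exists_offset d
  rw [Fin.le_def, blockIndex_val h h0 ho, blockIndex_val h h0 ho]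
  exact Nat.add_le_add_iff_left

theorem blockIndex_lt_iff {s : Fin m} {i j : Fin (d s)} :
    blockIndex d h ⟨s, i⟩ < blockIndex d h ⟨s, j⟩ ↔ i < j := by
  rw [← not_le, blockIndex_le_iff, not_le]

end blockIndex

/-- Everything reduces to `IsNested` with `z = o q`. As `1 ≤ q < m`, the first block is on the
descending side and the last on the ascending side; middle blocks qualify for either. -/
theorem IsNestedBlock.isMarkovUltrametric {m n : ℕ} {d : Fin m → ℕ} {h : ∑ s, d s = n}
    {B : Matrix (Fin n) (Fin n) ℝ} {f : Fin m → Fin m → ℝ} {q : ℕ} (H : IsNestedBlock d h B f q) :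
    IsMarkovUltrametric B := by
  obtain ⟨o, h0, ho⟩ := exists_offset d
  have hq₁ := H.one_le_q
  have hqm := H.q_lt
  let e := blockIndex d h
  have hlow : ∀ {s t} i j, t < s → B (e ⟨s, i⟩) (e ⟨t, j⟩) = 0 := fun {s t} i j hts =>
    congrFun (congrFun (H.lower s t hts) i) j
  have hup : ∀ {s t} i j, s < t → B (e ⟨s, i⟩) (e ⟨t, j⟩) = f s t := fun {s t} i j hst =>
    congrFun (congrFun (H.upper s t hst) i) j
  have hmid : ∀ s : Fin m, 0 < s.val → s.val + 1 < m → IsMiddleBlock (block d h B s s) (f s s) :=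
    fun s hs₀ hsm => isMiddleBlock_of_reindex (H.middle s hs₀ hsm)
  have hdesc : ∀ s : Fin m, s.val < q → IsDescendingBlock (block d h B s s) (f s s) := by
    intro s hs
    rcases Nat.eq_zero_or_pos s.val with hs₀ | hs₀
    · exact (H.first s hs₀).1.2.isDescendingBlock (H.first s hs₀).2
    · exact (hmid s hs₀ (by omega)).isDescendingBlock
  have hasc : ∀ s : Fin m, q ≤ s.val → IsAscendingBlock (block d h B s s) (f s s) := by
    intro s hs
    rcases (Nat.succ_le_of_lt s.2).eq_or_lt with hsm | hsm
    · exact (H.last s hsm).1.2.isAscendingBlock (H.last s hsm).2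
    · exact (hmid s (by omega) hsm).isAscendingBlock
  have hlt : ∀ {s i}, (e ⟨s, i⟩).val < o q ↔ s.val < q := by
    intro s i
    have hs := ho s
    simp only [e, blockIndex_val h h0 ho]
    constructor
    · intro hlt
      by_contra hsq
      have := offset_mono ho (not_lt.1 hsq) s.2.le
      omega
    · intro hsq
      have := offset_mono ho (Nat.succ_le_of_lt hsq) hqm.le
      simp only [Nat.succ_eq_add_one] at this
      omega
  have hge : ∀ {s i}, o q ≤ (e ⟨s, i⟩).val ↔ q ≤ s.val := fun {s i} => by
    rw [← not_lt, hlt, not_lt]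
  have hcross := H.cross ⟨q - 1, by omega⟩ ⟨q, hqm⟩ (Nat.sub_add_cancel hq₁) rfl
  have fpos : ∀ s, 0 < f s s := fun s =>
    (lt_or_ge s.val q).elim (H.left_pos s) (H.right_pos s)
  have hsurj : ∀ x, ∃ s i, e ⟨s, i⟩ = x := fun x =>
    let ⟨⟨s, i⟩, hx⟩ := blockIndex_surjective h x
    ⟨s, i, hx⟩
  have hle : ∀ {s t i j}, e ⟨s, i⟩ ≤ e ⟨t, j⟩ → s ≤ t := le_of_blockIndex_le h
  have hn : IsNested B (o q) (f ⟨q - 1, by omega⟩ ⟨q, hqm⟩) := by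
    refine ⟨fun x y => ?_, fun x y hxy hy => ?_, fun x y hxy hx => ?_, fun x y hx hy => ?_,
      fun x y l hxy hyl hl => ?_, fun x y l hxy hyl hx => ?_⟩
    · obtain ⟨s, i, rfl⟩ := hsurj x
      obtain ⟨t, j, rfl⟩ := hsurj y
      rcases lt_trichotomy s t with hst | rfl | hst
      · rw [hup _ _ hst]
        rcases lt_or_ge t.val q with ht | ht
        · rw [H.left_eq s t hst ht]; exact (fpos t).le
        · rcases lt_or_ge s.val q with hs | hs
          · exact (hcross s t hs ht).1.le
          · rw [H.right_eq s t hst hs]; exact (fpos s).le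
      · rcases lt_or_ge s.val q with hs | hs
        · exact (hdesc s hs).nonneg i j
        · exact (hasc s hs).nonneg i j
      · rw [hlow _ _ hst]
    · obtain ⟨s, i, rfl⟩ := hsurj x
      obtain ⟨t, j, rfl⟩ := hsurj y
      have ht := hlt.1 hy
      rcases (hle hxy).eq_or_lt with rfl | hst
      · exact (hdesc s ht).right i j ((blockIndex_le_iff h).1 hxy)
      · have hs : s.val < q := lt_trans hst ht
        have hM := hmid t (Nat.zero_lt_of_lt hst) (by omega)
        have hd : B (e ⟨t, j⟩) (e ⟨t, j⟩) = f t t := hM.eq j j le_rfl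
        rw [hup _ _ hst, hlow _ _ hst, hd, H.left_eq s t hst ht]
        exact ⟨rfl, (H.left_anti s t hst.le ht).trans ((hdesc s hs).le_diag i), (fpos t).le⟩
    · obtain ⟨s, i, rfl⟩ := hsurj x
      obtain ⟨t, j, rfl⟩ := hsurj y
      have hs := hge.1 hx
      rcases (hle hxy).eq_or_lt with rfl | hst
      · exact (hasc s hs).left i j ((blockIndex_le_iff h).1 hxy)
      · have ht : q ≤ t.val := hs.trans (Fin.le_def.1 hst.le)
        have hM := hmid s (by omega) (by have := Fin.lt_def.1 hst; omega)
        have hd : B (e ⟨s, i⟩) (e ⟨s, i⟩) = f s s := hM.eq i i le_rfl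
        rw [hup _ _ hst, hlow _ _ hst, hd, H.right_eq s t hst hs]
        exact ⟨rfl, (H.right_mono s t hst.le hs).trans ((hasc t ht).le_diag j), (fpos s).le⟩
    · obtain ⟨s, i, rfl⟩ := hsurj x
      obtain ⟨t, j, rfl⟩ := hsurj y
      have hs := hlt.1 hx
      have ht := hge.1 hy
      have hst : s < t := Fin.lt_def.2 (hs.trans_le ht)
      obtain ⟨-, c₁, c₂⟩ := hcross s t hs ht
      rw [c₁] at c₂
      obtain ⟨c₃, c₄⟩ := le_min_iff.1 c₂
      refine ⟨by rw [hup _ _ hst, c₁], hlow _ _ hst, c₃.trans ?_, c₄.trans ?_⟩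
      · exact (H.left_anti s ⟨q - 1, by omega⟩ (Fin.le_def.2 (Nat.le_sub_one_of_lt hs))
          (show q - 1 < q by omega)).trans ((hdesc s hs).le_diag i)
      · exact (H.right_mono ⟨q, hqm⟩ t ht le_rfl).trans ((hasc t ht).le_diag j)
    · obtain ⟨r, i, rfl⟩ := hsurj x
      obtain ⟨s, j, rfl⟩ := hsurj y
      obtain ⟨t, k, rfl⟩ := hsurj l
      have ht := hlt.1 hl
      -- The three alternatives of `left_lower` record where block boundaries fall. If `y` and `l`
      -- share a block without `x`, it is a middle block, so its diagonal is constant.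
      rcases (hle hyl.le).eq_or_lt with rfl | hst
      · rcases (hle hxy.le).eq_or_lt with rfl | hrs
        · exact Or.inr (Or.inr ((hdesc r ht).lower i j k ((blockIndex_lt_iff h).1 hxy)
            ((blockIndex_lt_iff h).1 hyl)))
        · have hM := hmid s (Nat.zero_lt_of_lt hrs) (by omega)
          exact Or.inr (Or.inl ⟨hlow _ _ hrs, hlow _ _ hrs,
            (hM.eq j j le_rfl).trans (hM.eq k k le_rfl).symm⟩)
      · exact Or.inl ⟨hlow _ _ hst, hlow _ _ ((hle hxy.le).trans_lt hst)⟩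
    · obtain ⟨r, i, rfl⟩ := hsurj x
      obtain ⟨s, j, rfl⟩ := hsurj y
      obtain ⟨t, k, rfl⟩ := hsurj l
      have hr := hge.1 hx
      rcases (hle hxy.le).eq_or_lt with rfl | hrs
      · rcases (hle hyl.le).eq_or_lt with rfl | hst
        · exact Or.inr (Or.inr ((hasc r hr).lower i j k ((blockIndex_lt_iff h).1 hxy)
            ((blockIndex_lt_iff h).1 hyl)))
        · have hM := hmid r (by omega) (by have := Fin.lt_def.1 hst; omega)
          exact Or.inr (Or.inl ⟨hlow _ _ hst, hlow _ _ hst,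
            (hM.eq j j le_rfl).trans (hM.eq i i le_rfl).symm⟩)
      · exact Or.inl ⟨hlow _ _ hrs, hlow _ _ (hrs.trans_le (hle hyl.le))⟩
  exact hn.isMarkovUltrametric

theorem IsNestedUpper.isMarkovUltrametric {n : ℕ} {B : Matrix (Fin n) (Fin n) ℝ}
    (h : IsNestedUpper B) : IsMarkovUltrametric B :=
  let ⟨_, _, _, _, _, H⟩ := h
  H.isMarkovUltrametric

/-! ### Direct sums and the equivalence -/

/-- As blocks are consecutive, a triple not inside one block has an outer index whose block contains
neither of the others; its relations to them are zero, and it is an apex. -/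
theorem IsDirectSumOf.isMarkovUltrametric {P : ∀ k : ℕ, Matrix (Fin k) (Fin k) ℝ → Prop} {n : ℕ}
    {C : Matrix (Fin n) (Fin n) ℝ} (h : IsDirectSumOf P C)
    (hP : ∀ k M, P k M → IsMarkovUltrametric M) : IsMarkovUltrametric C := by
  obtain ⟨m, d, h, M, hM, hC⟩ := h
  have hM := fun s => hP _ _ (hM s)
  let e := blockIndex d h
  have hsurj : ∀ x, ∃ s i, e ⟨s, i⟩ = x := fun x =>
    let ⟨⟨s, i⟩, hx⟩ := blockIndex_surjective h x
    ⟨s, i, hx⟩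
  have hle : ∀ {s t i j}, e ⟨s, i⟩ ≤ e ⟨t, j⟩ → s ≤ t := le_of_blockIndex_le h
  have hne : ∀ {s t} i j, s ≠ t → C (e ⟨s, i⟩) (e ⟨t, j⟩) = 0 := fun {s t} i j hst =>
    (congrFun (congrFun hC ⟨s, i⟩) ⟨t, j⟩).trans (Matrix.blockDiagonal'_apply_ne _ _ _ hst)
  have heq : ∀ {s} i j, C (e ⟨s, i⟩) (e ⟨s, j⟩) = M s i j := fun {s} i j =>
    (congrFun (congrFun hC ⟨s, i⟩) ⟨s, j⟩).trans (Matrix.blockDiagonal'_apply_eq _ _ _ _)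
  have hnn : ∀ x y, 0 ≤ C x y := by
    intro x y
    obtain ⟨s, i, rfl⟩ := hsurj x
    obtain ⟨t, j, rfl⟩ := hsurj y
    by_cases hst : s = t
    · subst hst; rw [heq]; exact (hM s).nonneg _ _
    · rw [hne _ _ hst]
  have hdiag : ∀ x y, C x y ≤ C x x ∧ C x y ≤ C y y := by
    intro x y
    obtain ⟨s, i, rfl⟩ := hsurj x
    obtain ⟨t, j, rfl⟩ := hsurj y
    by_cases hst : s = t
    · subst hst; simp only [heq]; exact ⟨(hM s).le_left _ _, (hM s).le_right _ _⟩
    · rw [hne _ _ hst]; exact ⟨hnn _ _, hnn _ _⟩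
  have key : ∀ x y l, x < y → y < l →
      (IsApex C x y l ∨ IsApex C y x l ∨ IsApex C l x y) ∧ C x l * C y y = C x y * C y l ∧
        C l x * C y y = C l y * C y x := by
    intro x y l hxy hyl
    obtain ⟨r, i, rfl⟩ := hsurj x
    obtain ⟨s, j, rfl⟩ := hsurj y
    obtain ⟨t, k, rfl⟩ := hsurj l
    have hrs := hle hxy.le
    have hst := hle hyl.le
    rcases hst.eq_or_lt with rfl | hst
    · rcases hrs.eq_or_lt with rfl | hrs
      · have h₁ := (blockIndex_lt_iff h).1 hxy
        have h₂ := (blockIndex_lt_iff h).1 hyl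
        simp only [IsApex, heq]
        exact ⟨(hM r).apex i j k h₁ h₂, (hM r).upper i j k h₁ h₂, (hM r).lower i j k h₁ h₂⟩
      · simp only [IsApex, hne _ _ hrs.ne, hne _ _ hrs.ne', min_self, max_self, zero_mul, mul_zero]
        exact ⟨Or.inl ⟨trivial, trivial, le_min (hnn _ _) (hnn _ _), (hnn _ _).trans (le_max_left _ _)⟩,
          trivial, trivial⟩
    · have hrt := hrs.trans_lt hst
      simp only [IsApex, hne _ _ hst.ne, hne _ _ hst.ne', hne _ _ hrt.ne, hne _ _ hrt.ne', min_self,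
        max_self, zero_mul, mul_zero]
      exact ⟨Or.inr (Or.inr ⟨trivial, trivial, le_min (hnn _ _) (hnn _ _),
        (hnn _ _).trans (le_max_left _ _)⟩), trivial, trivial⟩
  exact ⟨hnn, fun i j => (hdiag i j).1, fun i j => (hdiag i j).2,
    fun i j l hij hjl => (key i j l hij hjl).1, fun i j l hij hjl => (key i j l hij hjl).2.1,
    fun i j l hij hjl => (key i j l hij hjl).2.2⟩

end InverseTridiagonal

theorem mainTheorem12 (n : ℕ) (C : Matrix (Fin n) (Fin n) ℝ) (hC : IsUnit C) :
    List.TFAE [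
      InverseTridiagonal.IsDirectSumOf (fun _ M => InverseTridiagonal.IsPositiveCyclops M ∨
        InverseTridiagonal.IsNestedUpper M ∨
        InverseTridiagonal.IsNestedUpper (Matrix.transpose M)) C,
      InverseTridiagonal.IsGenUltrametric C ∧ InverseTridiagonal.IsTridiagonal C⁻¹,
      InverseTridiagonal.IsTotallyNonneg C ∧ InverseTridiagonal.IsGenUltrametric C] := by
  tfae_have 1 → 2 := fun h => by
    have hM := h.isMarkovUltrametric fun k M hM => by
      rcases hM with hM | hM | hM
      · exact hM.isMarkovUltrametric
      · exact hM.isMarkovUltrametric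
      · exact hM.isMarkovUltrametric.swap
    have hG := hM.isGenUltrametric
    exact ⟨hG, hM.isTridiagonal_inv (hG.diag_pos hC) hC⟩
  tfae_have 2 → 3 := fun ⟨hG, hT⟩ =>
    ⟨(hG.isMarkovUltrametric_of_inv hC hT).det_submatrix_nonneg (hG.diag_pos hC), hG⟩
  tfae_have 3 → 1 := fun ⟨hT, hG⟩ =>
    (hT.isMarkovUltrametric hG).isDirectSumOf (hG.diag_pos hC) hC
  tfae_finish
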